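/- Let $n\ge 1$, let $\mu$ be Lebesgue measure on $\mathbb C^n\cong\mathbb R^{2n}$ and $\mathfrak H=L^2(\mathbb C^n,e^{-|z|^2}d\mu)$. Let $\widetilde\Delta$ be the magnetic (Landau) Laplacian, that is, the closure in $\mathfrak H$ of the operator $$-\sum_{j=1}^n\frac{\partial^2}{\partial z_j\,\partial\overline{z_j}}+\sum_{j=1}^n\overline{z_j}\,\frac{\partial}{\partial\overline{z_j}}$$ with domain $C_c^\infty(\mathbb C^n)$. Then $\widetilde\Delta$ has exactly one spectral decomposition $\widetilde\Delta=\int_{\mathbb R}\lambda\,dE_\lambda$, where $(E_\lambda)_{\lambda\in\mathbb R}$ is an increasing, strongly right-continuous family of orthogonal projections tending strongly to $0$ as $\lambda\to-\infty$ and to the identity as $\lambda\to+\infty$ (so $E_\lambda$ is the spectral projection of $\widetilde\Delta$ for $(-\infty,\lambda]$). Its integrated density of states is $$\mathcal N_{\widetilde\Delta}(\lambda)=\frac{(\lfloor\lambda\rfloor+n)!}{\pi^n\,\lfloor\lambda\rfloor!\,n!}\quad(\lambda\ge 0),\qquad \mathcal N_{\widetilde\Delta}(\lambda)=0\quad(\lambda<0),$$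 in both of the following senses, for every $\lambda\in\mathbb R$. (a) For every bounded open $\Omega\subset\mathbb C^n$ the operator $\chi_\Omega E_\lambda\chi_\Omega$ is of trace class, and $$\mathcal N_{\widetilde\Delta}(\lambda)=\lim_{\Omega\to\mathbb C^n}\frac{\operatorname{tr}(\chi_\Omega E_\lambda\chi_\Omega)}{\operatorname{Vol}(\Omega)},$$ where $\operatorname{Vol}=\mu$ and the limit is over bounded open sets $\Omega$ containing arbitrarily large balls centred at $0$. (b) There is a continuous kernel $\Phi_\lambda(z,w)$, with $\Phi_\lambda(z,\cdot)\in\mathfrak H$ for every $z$, such that $E_\lambda[\phi](z)=\int_{\mathbb C^n}\Phi_\lambda(z,w)\phi(w)e^{-|w|^2}d\mu(w)$ for every $\phi\in\mathfrak H$ and almost every $z$; and for every such kernel and every measurable $\Omega\subset\mathbb C^n$ with $0<\operatorname{Vol}(\Omega)<\infty$, the function $\Phi_\lambda(z,z)e^{-|z|^2}$ is integrable on $\Omega$ and $$\mathcal N_{\widetilde\Delta}(\lambda)=\frac1{\operatorname{Vol}(\Omega)}\int_\Omega\Phi_\lambda(z,z)\,e^{-|z|^2}\,d\mu(z).$$ 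-/

import Mathlib

open MeasureTheory Filter Topology
open scoped ContDiff

noncomputable section

namespace MagneticLaplacian

/-! ### The Gaussian weighted space -/

/-- `ℂⁿ`; its `volume` is Lebesgue measure on `ℝ²ⁿ`. -/
abbrev Cn (n : ℕ) : Type := Fin n → ℂ

/-- The squared Euclidean norm `|z|² = ∑ⱼ |zⱼ|²`. -/
def sqNorm {n : ℕ} (z : Cn n) : ℝ := ∑ j, ‖z j‖ ^ 2

/-- The measure `e^{-|z|²} dμ(z)` on `ℂⁿ`. -/
def gaussianMeasure (n : ℕ) : Measure (Cn n) :=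
  (volume : Measure (Cn n)).withDensity fun z => ENNReal.ofReal (Real.exp (-sqNorm z))

/-- The Hilbert space `L²(ℂⁿ, e^{-|z|²} dμ)`. -/
abbrev L2 (n : ℕ) : Type := Lp ℂ 2 (gaussianMeasure n)

theorem continuous_sqNorm (n : ℕ) : Continuous (sqNorm : Cn n → ℝ) := by
  unfold sqNorm; fun_prop

instance (n : ℕ) : IsLocallyFiniteMeasure (gaussianMeasure n) :=
  IsLocallyFiniteMeasure.withDensity_ofReal (Real.continuous_exp.comp (continuous_sqNorm n).neg)

theorem volume_absolutelyContinuous (n : ℕ) :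
    (volume : Measure (Cn n)) ≪ gaussianMeasure n := by
  refine withDensity_absolutelyContinuous' ?_ ?_
  · exact (Real.continuous_exp.comp (continuous_sqNorm n).neg).measurable.ennreal_ofReal.aemeasurable
  · exact Eventually.of_forall fun z => by simp [Real.exp_pos]

instance (n : ℕ) : (gaussianMeasure n).IsOpenPosMeasure :=
  (volume_absolutelyContinuous n).isOpenPosMeasure

/-! ### The differential expression -/

/-- `∂f/∂xⱼ`, where `zⱼ = xⱼ + i yⱼ`. -/
def dX {n : ℕ} (j : Fin n) (f : Cn n → ℂ) (z : Cn n) : ℂ :=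
  fderiv ℝ f z (Pi.single j 1)

/-- `∂f/∂yⱼ`, where `zⱼ = xⱼ + i yⱼ`. -/
def dY {n : ℕ} (j : Fin n) (f : Cn n → ℂ) (z : Cn n) : ℂ :=
  fderiv ℝ f z (Pi.single j Complex.I)

/-- `∂f/∂zⱼ = (∂f/∂xⱼ - i ∂f/∂yⱼ) / 2`. -/
def dZ {n : ℕ} (j : Fin n) (f : Cn n → ℂ) (z : Cn n) : ℂ :=
  (1 / 2 : ℂ) * (dX j f z - Complex.I * dY j f z)

/-- `∂f/∂z̄ⱼ = (∂f/∂xⱼ + i ∂f/∂yⱼ) / 2`. -/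
def dZbar {n : ℕ} (j : Fin n) (f : Cn n → ℂ) (z : Cn n) : ℂ :=
  (1 / 2 : ℂ) * (dX j f z + Complex.I * dY j f z)

/-- The expression `-∑ⱼ ∂²f/∂zⱼ∂z̄ⱼ + ∑ⱼ z̄ⱼ ∂f/∂z̄ⱼ`. -/
def diffExpr {n : ℕ} (f : Cn n → ℂ) (z : Cn n) : ℂ :=
  -∑ j, dZ j (dZbar j f) z + ∑ j, (starRingEnd ℂ) (z j) * dZbar j f z

/-- Test functions: smooth functions `ℂⁿ → ℂ` of compact support. -/
def testFun (n : ℕ) : Submodule ℂ (Cn n → ℂ) where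
  carrier := {f | ContDiff ℝ ∞ f ∧ HasCompactSupport f}
  zero_mem' := ⟨contDiff_const, HasCompactSupport.zero⟩
  add_mem' hf hg := ⟨hf.1.add hg.1, hf.2.add hg.2⟩
  smul_mem' c _ hf := ⟨contDiff_const.smul hf.1, hf.2.smul_left (f := fun _ => c)⟩

theorem fderiv_apply_mem {n : ℕ} {f : Cn n → ℂ} (hf : f ∈ testFun n) (v : Cn n) :
    (fun z => fderiv ℝ f z v) ∈ testFun n :=
  ⟨(hf.1.fderiv_right (m := ∞) (by simp)).clm_apply contDiff_const,
    hf.2.fderiv_apply (𝕜 := ℝ) v⟩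

theorem dZ_mem {n : ℕ} (j : Fin n) {f : Cn n → ℂ} (hf : f ∈ testFun n) :
    dZ j f ∈ testFun n :=
  (testFun n).smul_mem _ ((testFun n).sub_mem (fderiv_apply_mem hf _)
    ((testFun n).smul_mem _ (fderiv_apply_mem hf _)))

theorem dZbar_mem {n : ℕ} (j : Fin n) {f : Cn n → ℂ} (hf : f ∈ testFun n) :
    dZbar j f ∈ testFun n :=
  (testFun n).smul_mem _ ((testFun n).add_mem (fderiv_apply_mem hf _)
    ((testFun n).smul_mem _ (fderiv_apply_mem hf _)))

theorem conj_mul_mem {n : ℕ} (j : Fin n) {f : Cn n → ℂ} (hf : f ∈ testFun n) :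
    (fun z => (starRingEnd ℂ) (z j) * f z) ∈ testFun n := by
  refine ⟨ContDiff.mul ?_ hf.1, hf.2.mul_left⟩
  exact Complex.conjCLE.contDiff.comp (contDiff_apply ℝ ℂ j)

theorem diffExpr_mem {n : ℕ} {f : Cn n → ℂ} (hf : f ∈ testFun n) :
    diffExpr f ∈ testFun n := by
  have h : diffExpr f = -(∑ j, dZ j (dZbar j f))
      + ∑ j, fun z => (starRingEnd ℂ) (z j) * dZbar j f z := by
    funext z; simp [diffExpr, Finset.sum_apply]
  rw [h]
  exact (testFun n).add_mem
    ((testFun n).neg_mem ((testFun n).sum_mem fun j _ => dZ_mem j (dZbar_mem j hf)))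
    ((testFun n).sum_mem fun j _ => conj_mul_mem j (dZbar_mem j hf))

theorem differentiable_of_mem {n : ℕ} {f : Cn n → ℂ} (hf : f ∈ testFun n) :
    Differentiable ℝ f := hf.1.differentiable (by simp)

theorem dZ_add {n : ℕ} (j : Fin n) {f g : Cn n → ℂ} (hf : f ∈ testFun n) (hg : g ∈ testFun n) :
    dZ j (f + g) = dZ j f + dZ j g := by
  funext z
  simp only [dZ, dX, dY, Pi.add_apply,
    fderiv_add (differentiable_of_mem hf z) (differentiable_of_mem hg z), add_apply]
  ring

theorem dZbar_add {n : ℕ} (j : Fin n) {f g : Cn n → ℂ} (hf : f ∈ testFun n)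
    (hg : g ∈ testFun n) : dZbar j (f + g) = dZbar j f + dZbar j g := by
  funext z
  simp only [dZbar, dX, dY, Pi.add_apply,
    fderiv_add (differentiable_of_mem hf z) (differentiable_of_mem hg z), add_apply]
  ring

theorem dZ_smul {n : ℕ} (j : Fin n) (c : ℂ) {f : Cn n → ℂ} (hf : f ∈ testFun n) :
    dZ j (c • f) = c • dZ j f := by
  funext z
  simp only [dZ, dX, dY, Pi.smul_apply, smul_eq_mul,
    fderiv_const_smul (differentiable_of_mem hf z) c, FunLike.coe_smul]
  ring

theorem dZbar_smul {n : ℕ} (j : Fin n) (c : ℂ) {f : Cn n → ℂ} (hf : f ∈ testFun n) :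
    dZbar j (c • f) = c • dZbar j f := by
  funext z
  simp only [dZbar, dX, dY, Pi.smul_apply, smul_eq_mul,
    fderiv_const_smul (differentiable_of_mem hf z) c, FunLike.coe_smul]
  ring

/-- The differential expression as a linear map on test functions. -/
def testOp (n : ℕ) : testFun n →ₗ[ℂ] testFun n where
  toFun f := ⟨diffExpr f.1, diffExpr_mem f.2⟩
  map_add' f g := by
    ext z
    simp only [diffExpr, Submodule.coe_add, dZbar_add _ f.2 g.2,
      dZ_add _ (dZbar_mem _ f.2) (dZbar_mem _ g.2), Pi.add_apply, mul_add, Finset.sum_add_distrib]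
    ring
  map_smul' c f := by
    ext z
    simp only [diffExpr, Submodule.coe_smul, dZbar_smul _ c f.2,
      dZ_smul _ c (dZbar_mem _ f.2), Pi.smul_apply, smul_eq_mul, RingHom.id_apply,
      mul_left_comm _ c, ← Finset.mul_sum]
    ring

/-- The inclusion of test functions into `L²(ℂⁿ, e^{-|z|²} dμ)`. -/
def testToL2 (n : ℕ) : testFun n →ₗ[ℂ] L2 n where
  toFun f := MemLp.toLp f.1 (f.2.1.continuous.memLp_of_hasCompactSupport f.2.2)
  map_add' _ _ := MemLp.toLp_add _ _
  map_smul' _ _ := MemLp.toLp_const_smul _ _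

theorem testToL2_injective (n : ℕ) : Function.Injective (testToL2 n) := by
  intro f g h
  have h' : f.1 =ᵐ[gaussianMeasure n] g.1 :=
    (MemLp.toLp_eq_toLp_iff (f.2.1.continuous.memLp_of_hasCompactSupport f.2.2)
      (g.2.1.continuous.memLp_of_hasCompactSupport g.2.2)).1 h
  exact Subtype.ext ((f.2.1.continuous.ae_eq_iff_eq _ g.2.1.continuous).1 h')

/-- The operator `-∑ⱼ ∂²/∂zⱼ∂z̄ⱼ + ∑ⱼ z̄ⱼ ∂/∂z̄ⱼ` in `L²(ℂⁿ, e^{-|z|²} dμ)` with domain the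
test functions. -/
def minimalOp (n : ℕ) : L2 n →ₗ.[ℂ] L2 n where
  domain := LinearMap.range (testToL2 n)
  toFun := testToL2 n ∘ₗ testOp n ∘ₗ
    (LinearEquiv.ofInjective (testToL2 n) (testToL2_injective n)).symm.toLinearMap

/-- The magnetic Laplacian: the closure of `minimalOp` in `L²(ℂⁿ, e^{-|z|²} dμ)`. -/
def magneticLaplacian (n : ℕ) : L2 n →ₗ.[ℂ] L2 n := (minimalOp n).closure

/-! ### Spectral families and the spectral decomposition of an operator -/

/-- A spectral family (resolution of the identity) in a Hilbert space: an increasing, strongly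
right-continuous family of orthogonal projections tending strongly to `0` at `-∞` and to the
identity at `+∞`. -/
structure SpectralFamily (H : Type) [NormedAddCommGroup H] [InnerProductSpace ℂ H]
    [CompleteSpace H] where
  proj : ℝ → H →L[ℂ] H
  isStarProjection : ∀ t, IsStarProjection (proj t)
  increasing : ∀ s t, s ≤ t → ∀ f, proj t (proj s f) = proj s f
  right_continuous : ∀ t f, ContinuousWithinAt (fun s => proj s f) (Set.Ici t) t
  tendsto_atBot : ∀ f, Tendsto (fun t => proj t f) atBot (𝓝 0)
  tendsto_atTop : ∀ f, Tendsto (fun t => proj t f) atTop (𝓝 f)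

namespace SpectralFamily

variable {H : Type} [NormedAddCommGroup H] [InnerProductSpace ℂ H] [CompleteSpace H]

theorem proj_comp_of_le (E : SpectralFamily H) {s t : ℝ} (h : s ≤ t) (f : H) :
    E.proj s (E.proj t f) = E.proj s f := by
  refine ext_inner_left ℂ fun g => ?_
  have sa : ∀ r (x y : H), inner ℂ x (E.proj r y) = inner ℂ (E.proj r x) y := fun r x y =>
    (((E.isStarProjection r).isSelfAdjoint.isSymmetric) x y).symm
  rw [sa, sa, E.increasing s t h, sa]

theorem norm_proj_le (E : SpectralFamily H) (t : ℝ) (f : H) : ‖E.proj t f‖ ≤ ‖f‖ := by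
  by_cases h0 : ‖E.proj t f‖ = 0
  · rw [h0]; exact norm_nonneg f
  have hsa : inner ℂ (E.proj t f) (E.proj t f) = inner ℂ f (E.proj t f) := by
    have h : inner ℂ (E.proj t f) (E.proj t f) = inner ℂ f (E.proj t (E.proj t f)) :=
      ((E.isStarProjection t).isSelfAdjoint.isSymmetric) f (E.proj t f)
    rw [E.increasing t t le_rfl] at h
    exact h
  have h1 : ‖E.proj t f‖ * ‖E.proj t f‖ ≤ ‖f‖ * ‖E.proj t f‖ := by
    rw [← inner_self_eq_norm_mul_norm (𝕜 := ℂ), hsa]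
    exact (RCLike.re_le_norm _).trans (norm_inner_le_norm _ _)
  exact le_of_mul_le_mul_right h1 (lt_of_le_of_ne (norm_nonneg _) (Ne.symm h0))

/-- The distribution function `t ↦ ‖E_t f‖² = ⟨E_t f, f⟩`. -/
def distribution (E : SpectralFamily H) (f : H) : StieltjesFunction ℝ where
  toFun t := ‖E.proj t f‖ ^ 2
  mono' s t h := by
    have := E.norm_proj_le s (E.proj t f)
    rw [E.proj_comp_of_le h] at this
    exact pow_le_pow_left₀ (norm_nonneg _) this 2
  right_continuous' t := (E.right_continuous t f).norm.pow 2

/-- The spectral measure `d⟨E_t f, f⟩` of `f`. -/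
def spectralMeasure (E : SpectralFamily H) (f : H) : Measure ℝ := (E.distribution f).measure

/-- `T = ∫ t dE_t`: the domain of `T` is `{f | ∫ t² d⟨E_t f, f⟩ < ∞}`, and there
`⟨T f, f⟩ = ∫ t d⟨E_t f, f⟩` and `‖T f‖² = ∫ t² d⟨E_t f, f⟩`. -/
structure Decomposes (E : SpectralFamily H) (T : H →ₗ.[ℂ] H) : Prop where
  mem_domain_iff : ∀ f, f ∈ T.domain ↔ Integrable (fun t : ℝ => t ^ 2) (E.spectralMeasure f)
  inner_eq : ∀ f : T.domain,
    inner ℂ (T f) (f : H) = ((∫ t, t ∂(E.spectralMeasure (f : H)) : ℝ) : ℂ)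
  norm_sq_eq : ∀ f : T.domain, ‖T f‖ ^ 2 = ∫ t, t ^ 2 ∂(E.spectralMeasure (f : H))

end SpectralFamily

/-! ### Integrated density of states -/

/-- `A` is of trace class with trace `t`: over every Hilbert basis the diagonal matrix entries
of `A` are (absolutely) summable, with sum `t`. -/
def HasTrace {H : Type} [NormedAddCommGroup H] [InnerProductSpace ℂ H] [CompleteSpace H]
    (A : H →L[ℂ] H) (t : ℂ) : Prop :=
  ∀ (ι : Type) (b : HilbertBasis ι ℂ H), HasSum (fun i => inner ℂ (b i) (A (b i))) t

/-- Multiplication by the characteristic function of `Ω`, on `L²(ℂⁿ, e^{-|z|²} dμ)`. -/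
def mulChar {n : ℕ} (Ω : Set (Cn n)) (hΩ : MeasurableSet Ω) : L2 n →L[ℂ] L2 n :=
  LinearMap.mkContinuous
    { toFun := fun f => MemLp.toLp (Ω.indicator f) ((Lp.memLp f).indicator hΩ)
      map_add' := fun f g => by
        rw [← MemLp.toLp_add, MemLp.toLp_eq_toLp_iff, ← Set.indicator_add']
        exact (Lp.coeFn_add f g).indicator
      map_smul' := fun c f => by
        rw [RingHom.id_apply, ← MemLp.toLp_const_smul, MemLp.toLp_eq_toLp_iff]
        refine (Lp.coeFn_smul c f).indicator.trans (Eventually.of_forall fun z => ?_)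
        exact congrFun (Set.indicator_const_smul Ω c f) z } 1
    (fun f => by
      rw [one_mul]
      refine Lp.norm_le_norm_of_ae_le ?_
      filter_upwards [((Lp.memLp f).indicator hΩ).coeFn_toLp] with z hz
      exact (congrArg norm hz).trans_le (norm_indicator_le_norm_self _ _))

/-- The filter "`Ω → ℂⁿ` through bounded open sets": a property holds eventually if it holds for
all bounded open sets containing a large enough ball. -/
def expanding (n : ℕ) : Filter (Set (Cn n)) :=
  ⨅ R : ℝ, 𝓟 {Ω | IsOpen Ω ∧ Bornology.IsBounded Ω ∧ Metric.ball 0 R ⊆ Ω}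

/-- `lim_{Ω → ℂⁿ} tr(χ_Ω P χ_Ω) / Vol(Ω) = c`, the operators `χ_Ω P χ_Ω` being of trace class. -/
def HasTraceDensity {n : ℕ} (P : L2 n →L[ℂ] L2 n) (c : ℝ) : Prop :=
  ∃ tr : Set (Cn n) → ℝ,
    (∀ (Ω : Set (Cn n)) (hΩ : IsOpen Ω), Bornology.IsBounded Ω →
      HasTrace (mulChar Ω hΩ.measurableSet ∘L P ∘L mulChar Ω hΩ.measurableSet) (tr Ω : ℂ)) ∧
    Tendsto (fun Ω => tr Ω / volume.real Ω) (expanding n) (𝓝 c)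

/-- `K` is a continuous integral kernel of `P`:
`P[φ](z) = ∫ K(z, w) φ(w) e^{-|w|²} dμ(w)` for all `φ`. -/
structure IsContinuousKernel {n : ℕ} (P : L2 n →L[ℂ] L2 n) (K : Cn n → Cn n → ℂ) : Prop where
  continuous : Continuous fun p : Cn n × Cn n => K p.1 p.2
  memLp : ∀ z, MemLp (K z) 2 (gaussianMeasure n)
  apply_ae : ∀ φ : L2 n,
    P φ =ᵐ[gaussianMeasure n] fun z => ∫ w, K z w * φ w ∂(gaussianMeasure n)

/-- `P` has a continuous kernel `K`, and the average
`Vol(Ω)⁻¹ ∫_Ω K(z, z) e^{-|z|²} dμ(z)` of its diagonal over any set `Ω` of positive finite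
volume is `c`. -/
def HasKernelDensity {n : ℕ} (P : L2 n →L[ℂ] L2 n) (c : ℝ) : Prop :=
  (∃ K, IsContinuousKernel P K) ∧
  ∀ K, IsContinuousKernel P K → ∀ Ω : Set (Cn n), MeasurableSet Ω →
    volume Ω ≠ 0 → volume Ω ≠ ⊤ →
    IntegrableOn (fun z => K z z) Ω (gaussianMeasure n) ∧
    (∫ z in Ω, K z z ∂(gaussianMeasure n)) / ((volume.real Ω : ℝ) : ℂ) = (c : ℂ)

/-- `N` is the integrated density of states of the spectral family `E`: for every `t`, it is the
volume density at `t` of the spectral projection `E_t`, both as limit of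
`tr(χ_Ω E_t χ_Ω) / Vol(Ω)` and as average of the diagonal of the kernel of `E_t`. -/
def IsIntegratedDensityOfStates {n : ℕ} (E : SpectralFamily (L2 n)) (N : ℝ → ℝ) : Prop :=
  ∀ t : ℝ, HasTraceDensity (E.proj t) (N t) ∧ HasKernelDensity (E.proj t) (N t)

end MagneticLaplacian

end

noncomputable section

namespace MagneticLaplacian

/-! Put `A_j = ∂/∂z̄_j`. Integration by parts against the Gaussian weight shows that its adjoint is
`A_j* = -∂/∂z_j + z̄_j`, so the operator is `∑ A_j* A_j` with `[A_j, A_j*] = 1`: a sum of harmonic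
oscillators. Applying powers of `A_j*` to holomorphic monomials gives products of the complex
Hermite polynomials `(-∂/∂z + z̄)^q z^p`. They are orthogonal eigenfunctions with eigenvalue `∑
q_j`, and the free exponents `p` make every level infinitely degenerate.

These functions span the polynomials in `z` and `z̄`, hence are complete
(`eq_zero_of_forall_inner_basisVec`). Cutoffs put them in the closure of the graph
(`hermite_mem_closure`), and symmetry bounds that closure from above. So the magnetic Laplacian is
the maximal diagonal operator with these eigenvalues (`mem_graph_magneticLaplacian_iff`). Its
spectral family is explicit, and it is unique because the spectral measure of an eigenvector is
concentrated at the eigenvalue (`Decomposes.proj_eigenvector`).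

The projection onto the level `q` in one variable has as kernel a multiple of the conjugate of the
magnetic translate to `z` of the Hermite function with indices `(q, q)`. On the diagonal this kernel
equals `e^{|z|²}/π` for every `q` (`levelKernel_self`). In `n` variables each multi-index `q`
therefore contributes `e^{|z|²}/πⁿ`, and the multi-indices with `∑ q_j ≤ ⌊λ⌋` number `(⌊λ⌋ +
n).choose n`. After multiplication by the weight the diagonal is constant, which gives the average
in (b) exactly. For (a), Parseval's identity applied to the kernel at fixed `z` evaluates `∑
|e_a(z)|²` over the basis functions of level at most `λ`. Tonelli's theorem then yields a trace
exactly proportional to `Vol(Ω)`, so the limit is that of an eventually constant quotient. -/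

theorem HasSum.congr_term {α ι : Type*} [AddCommMonoid α] [TopologicalSpace α] {f g : ι → α} {a : α}
    (h : HasSum f a) (hfg : ∀ i, f i = g i) : HasSum g a := by
  rwa [← funext hfg]

/-! ### Coordinates in a Hilbert basis -/

section HilbertBasis

variable {H : Type} [NormedAddCommGroup H] [InnerProductSpace ℂ H] {ι : Type}

theorem hilbertBasis_ext (b : HilbertBasis ι ℂ H) {x y : H}
    (h : ∀ i, inner ℂ (b i) x = inner ℂ (b i) y) : x = y := by
  apply b.repr.injective
  ext i
  simpa only [b.repr_apply_apply] using h i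

theorem hasSum_sq_norm_inner (b : HilbertBasis ι ℂ H) (x : H) :
    HasSum (fun i => ‖inner ℂ (b i) x‖ ^ 2) (‖x‖ ^ 2) := by
  have h := b.hasSum_inner_mul_inner x x
  rw [inner_self_eq_norm_sq_to_K] at h
  have h2 : HasSum (fun i => ((‖inner ℂ (b i) x‖ ^ 2 : ℝ) : ℂ)) ((‖x‖ ^ 2 : ℝ) : ℂ) := by
    have h3 : ((‖x‖ ^ 2 : ℝ) : ℂ) = (RCLike.ofReal ‖x‖ : ℂ) ^ 2 := by push_cast; rfl
    rw [h3]
    refine HasSum.congr_term h fun i => ?_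
    rw [← inner_conj_symm x (b i), RCLike.conj_mul]
    push_cast
    rfl
  exact_mod_cast h2

theorem inner_hilbertBasis (b : HilbertBasis ι ℂ H) [DecidableEq ι] (i j : ι) :
    inner ℂ (b i) (b j) = if i = j then 1 else 0 :=
  orthonormal_iff_ite.1 b.orthonormal i j

theorem exists_inner_eq (b : HilbertBasis ι ℂ H) (c : ι → ℂ) (hc : Summable fun i => ‖c i‖ ^ 2) :
    ∃ x : H, ∀ i, inner ℂ (b i) x = c i := by
  have hm : Memℓp c 2 := by
    refine memℓp_gen ?_
    simpa using hc
  refine ⟨b.repr.symm ⟨c, hm⟩, fun i => ?_⟩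
  rw [← b.repr_apply_apply, LinearIsometryEquiv.apply_symm_apply]

variable [CompleteSpace H]

/-- The orthogonal projection onto the closed span of the basis vectors with index in `s`. -/
def projOn (b : HilbertBasis ι ℂ H) (s : Set ι) : H →L[ℂ] H :=
  (Submodule.span ℂ (b '' s)).topologicalClosure.starProjection

theorem inner_projOn (b : HilbertBasis ι ℂ H) (s : Set ι) [DecidablePred (· ∈ s)] (i : ι) (x : H) :
    inner ℂ (b i) (projOn b s x) = if i ∈ s then inner ℂ (b i) x else 0 := by
  classical
  split_ifs with hi
  · rw [projOn, ← Submodule.inner_starProjection_left_eq_right,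
      Submodule.starProjection_eq_self_iff.2]
    exact Submodule.le_topologicalClosure _ (Submodule.subset_span ⟨i, hi, rfl⟩)
  · have hK : b i ∈ (Submodule.span ℂ (b '' s)).topologicalClosureᗮ := by
      rw [Submodule.orthogonal_closure, Submodule.mem_orthogonal]
      intro u hu
      induction hu using Submodule.span_induction with
      | mem u hu =>
        obtain ⟨j, hj, rfl⟩ := hu
        rw [inner_hilbertBasis, if_neg]
        rintro rfl
        exact hi hj
      | zero => simp
      | add x y _ _ hx hy => rw [inner_add_left, hx, hy, add_zero]
      | smul c x _ hx => rw [inner_smul_left, hx, mul_zero]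
    rw [projOn, ← Submodule.inner_starProjection_left_eq_right,
      (Submodule.starProjection_apply_eq_zero_iff _).2 hK, inner_zero_left]

theorem hasSum_sq_norm_projOn (b : HilbertBasis ι ℂ H) (s : Set ι) [DecidablePred (· ∈ s)] (x : H) :
    HasSum (fun i => if i ∈ s then ‖inner ℂ (b i) x‖ ^ 2 else 0) (‖projOn b s x‖ ^ 2) := by
  convert hasSum_sq_norm_inner b (projOn b s x) using 2 with i
  rw [inner_projOn]
  split_ifs <;> simp

end HilbertBasis

namespace SpectralFamily

variable {H : Type} [NormedAddCommGroup H] [InnerProductSpace ℂ H] [CompleteSpace H]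

/-! ### The spectral measure of an eigenvector -/

/-- Pythagoras for an orthogonal projection; it turns equality of norms into `E.proj t x = x`. -/
theorem norm_sub_proj_sq (E : SpectralFamily H) (t : ℝ) (x : H) :
    ‖x - E.proj t x‖ ^ 2 = ‖x‖ ^ 2 - ‖E.proj t x‖ ^ 2 := by
  have h1 : inner ℂ x (E.proj t x) = ((‖E.proj t x‖ ^ 2 : ℝ) : ℂ) := by
    have h : inner ℂ (E.proj t x) (E.proj t x) = inner ℂ x (E.proj t (E.proj t x)) :=
      ((E.isStarProjection t).isSelfAdjoint.isSymmetric) x (E.proj t x)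
    rw [E.increasing t t le_rfl, inner_self_eq_norm_sq_to_K] at h
    rw [← h]; norm_cast
  rw [@norm_sub_sq ℂ, h1]
  simp only [RCLike.re_to_complex, Complex.ofReal_re]
  ring

theorem distribution_apply (E : SpectralFamily H) (f : H) (t : ℝ) :
    E.distribution f t = ‖E.proj t f‖ ^ 2 := rfl

theorem distribution_tendsto_atBot (E : SpectralFamily H) (f : H) :
    Tendsto (E.distribution f) atBot (𝓝 0) := by
  have h := ((E.tendsto_atBot f).norm.pow 2)
  rw [norm_zero, zero_pow two_ne_zero] at h
  exact h

theorem distribution_tendsto_atTop (E : SpectralFamily H) (f : H) :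
    Tendsto (E.distribution f) atTop (𝓝 (‖f‖ ^ 2)) :=
  (E.tendsto_atTop f).norm.pow 2

instance (E : SpectralFamily H) (f : H) : IsFiniteMeasure (E.spectralMeasure f) :=
  (E.distribution f).isFiniteMeasure (E.distribution_tendsto_atBot f)
    (E.distribution_tendsto_atTop f)

theorem spectralMeasure_Iic (E : SpectralFamily H) (f : H) (t : ℝ) :
    E.spectralMeasure f (Set.Iic t) = ENNReal.ofReal (‖E.proj t f‖ ^ 2) := by
  rw [spectralMeasure, StieltjesFunction.measure_Iic _ (E.distribution_tendsto_atBot f), sub_zero,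
    distribution_apply]

theorem spectralMeasure_univ (E : SpectralFamily H) (f : H) :
    E.spectralMeasure f Set.univ = ENNReal.ofReal (‖f‖ ^ 2) := by
  rw [spectralMeasure, StieltjesFunction.measure_univ _ (E.distribution_tendsto_atBot f)
    (E.distribution_tendsto_atTop f), sub_zero]

theorem integrable_id_of_sq {μ : Measure ℝ} [IsFiniteMeasure μ]
    (h : Integrable (fun t : ℝ => t ^ 2) μ) : Integrable (fun t : ℝ => t) μ := by
  refine ((integrable_const (1 : ℝ)).add h).mono' measurable_id.aestronglyMeasurable
    (Eventually.of_forall fun t => ?_)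
  rw [Real.norm_eq_abs, Pi.add_apply]
  nlinarith [sq_nonneg (|t| - 1), sq_abs t, abs_nonneg t]

/-- The moments of order 0, 1, 2 of the spectral measure of an eigenvector are `‖x‖²`, `q‖x‖²`,
`q²‖x‖²`. So its second moment about `q` vanishes and the measure is concentrated at `q`; its mass
on `(-∞, t]` then determines the projection. -/
theorem Decomposes.proj_eigenvector {E : SpectralFamily H} {T : H →ₗ.[ℂ] H} (hE : E.Decomposes T)
    {q : ℝ} (x : T.domain) (hx : T x = (q : ℂ) • (x : H)) (t : ℝ) :
    E.proj t x = if q ≤ t then (x : H) else 0 := by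
  set μ := E.spectralMeasure (x : H) with hμ
  have i2 : Integrable (fun t : ℝ => t ^ 2) μ := (hE.mem_domain_iff x).1 x.2
  have i1 : Integrable (fun t : ℝ => t) μ := integrable_id_of_sq i2
  have e2 : ∫ t, t ^ 2 ∂μ = q ^ 2 * ‖(x : H)‖ ^ 2 := by
    rw [← hE.norm_sq_eq x, hx, norm_smul, mul_pow, Complex.norm_real, Real.norm_eq_abs, sq_abs]
  have e1 : ∫ t, t ∂μ = q * ‖(x : H)‖ ^ 2 := by
    have h := hE.inner_eq x
    rw [hx, inner_smul_left, inner_self_eq_norm_sq_to_K, Complex.conj_ofReal, ← hμ] at h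
    have h' : ((∫ t, t ∂μ : ℝ) : ℂ) = ((q * ‖(x : H)‖ ^ 2 : ℝ) : ℂ) := by
      rw [← h]
      push_cast
      rfl
    exact Complex.ofReal_injective h'
  have e0 : μ.real Set.univ = ‖(x : H)‖ ^ 2 := by
    rw [Measure.real, hμ, E.spectralMeasure_univ, ENNReal.toReal_ofReal (by positivity)]
  have iz : Integrable (fun t : ℝ => (t - q) ^ 2) μ := by
    have : (fun t : ℝ => (t - q) ^ 2) = fun t => t ^ 2 - 2 * q * t + q ^ 2 := by
      funext t; ring
    rw [this]
    exact (i2.sub (i1.const_mul _)).add (integrable_const _)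
  have ez : ∫ t, (t - q) ^ 2 ∂μ = 0 := by
    have : (fun t : ℝ => (t - q) ^ 2) = fun t => t ^ 2 - 2 * q * t + q ^ 2 := by
      funext t; ring
    rw [this, integral_add (f := fun t => t ^ 2 - 2 * q * t) (i2.sub (i1.const_mul _))
      (integrable_const _), integral_sub i2 (i1.const_mul _), integral_const_mul, e2, e1,
      integral_const, e0, smul_eq_mul]
    ring
  have hae : ∀ᵐ s ∂μ, s = q := by
    rw [integral_eq_zero_iff_of_nonneg (fun s => sq_nonneg _) iz] at ez
    filter_upwards [ez] with s hs
    have : (s - q) ^ 2 = 0 := hs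
    nlinarith [pow_eq_zero_iff (two_ne_zero) |>.1 this]
  split_ifs with hq
  · have h1 : μ (Set.Iic t) = μ Set.univ := by
      refine measure_congr ?_
      filter_upwards [hae] with s hs
      refine propext ⟨fun _ => trivial, fun _ => ?_⟩
      change s ≤ t
      rw [hs]; exact hq
    rw [hμ, E.spectralMeasure_Iic, E.spectralMeasure_univ,
      ENNReal.ofReal_eq_ofReal_iff (by positivity) (by positivity)] at h1
    have h2 := E.norm_sub_proj_sq t (x : H)
    rw [h1, sub_self, sq_eq_zero_iff, norm_eq_zero, sub_eq_zero] at h2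
    exact h2.symm
  · have h1 : μ (Set.Iic t) = 0 := by
      rw [← nonpos_iff_eq_zero, ← ae_iff.1 hae]
      refine measure_mono fun s hs => ?_
      have hs' : s ≤ t := hs
      simp only [Set.mem_ofPred_eq]
      rintro rfl
      exact hq hs'
    rw [hμ, E.spectralMeasure_Iic, ENNReal.ofReal_eq_zero] at h1
    exact norm_eq_zero.1 (sq_eq_zero_iff.1 (le_antisymm h1 (by positivity)))

@[ext]
theorem ext_proj {E F : SpectralFamily H} (h : ∀ t, E.proj t = F.proj t) : E = F := by
  cases E; cases F
  congr
  exact funext h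

variable {ι : Type}

/-- Two spectral families that decompose an operator with a Hilbert basis of eigenvectors agree. -/
theorem Decomposes.eq_of_eigenbasis {E F : SpectralFamily H} {T : H →ₗ.[ℂ] H}
    (hE : E.Decomposes T) (hF : F.Decomposes T) (b : HilbertBasis ι ℂ H) (d : ι → ℝ)
    (hb : ∀ i, (b i, (d i : ℂ) • b i) ∈ T.graph) : E = F := by
  ext1 t
  refine ContinuousLinearMap.ext_on ((Submodule.dense_iff_topologicalClosure_eq_top).2 b.dense_span) ?_
  rintro _ ⟨i, rfl⟩
  obtain ⟨x, hx, hT⟩ := (LinearPMap.mem_graph_iff _).1 (hb i)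
  simp only at hx hT
  rw [← hx] at hT ⊢
  rw [hE.proj_eigenvector x hT, hF.proj_eigenvector x hT]

/-! ### The spectral family of a diagonal operator -/

/-- The spectral family of the operator that has the `b i` as eigenvectors, with eigenvalues
`d i ∈ ℕ`. -/
def ofEigenbasis (b : HilbertBasis ι ℂ H) (d : ι → ℕ) : SpectralFamily H where
  proj t := projOn b {i | (d i : ℝ) ≤ t}
  isStarProjection t := isStarProjection_starProjection
  increasing s t h f := by
    classical
    refine hilbertBasis_ext b fun i => ?_
    simp only [inner_projOn, Set.mem_ofPred_eq]
    by_cases h2 : (d i : ℝ) ≤ s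
    · rw [if_pos (h2.trans h)]
    · rw [if_neg h2, ite_self]
  right_continuous t f := by
    -- The eigenvalues are integers, so the index set does not change for `s` in `[t, ⌊t⌋ + 1)`.
    have hev : ∀ᶠ s in 𝓝[Set.Ici t] t,
        projOn b {i | (d i : ℝ) ≤ s} f = projOn b {i | (d i : ℝ) ≤ t} f := by
      have h1 : ∀ᶠ s in 𝓝[Set.Ici t] t, s < (⌊t⌋ + 1 : ℝ) :=
        (eventually_lt_nhds (Int.lt_floor_add_one t)).filter_mono nhdsWithin_le_nhds
      filter_upwards [h1, self_mem_nhdsWithin] with s hs hts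
      congr 2
      ext i
      simp only [Set.mem_ofPred_eq]
      refine ⟨fun hi => ?_, fun hi => hi.trans hts⟩
      have h2 : ((d i : ℤ) : ℝ) < ((⌊t⌋ + 1 : ℤ) : ℝ) := by
        push_cast
        exact lt_of_le_of_lt hi hs
      have h3 : (d i : ℤ) ≤ ⌊t⌋ := Int.lt_add_one_iff.1 (Int.cast_lt.1 h2)
      have h4 := Int.le_floor.1 h3
      exact_mod_cast h4
    exact (tendsto_const_nhds).congr' (EventuallyEq.symm hev)
  tendsto_atBot f := by
    classical
    refine (tendsto_const_nhds (x := (0 : H))).congr' ?_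
    filter_upwards [eventually_lt_atBot (0 : ℝ)] with t ht
    refine hilbertBasis_ext b fun i => ?_
    rw [inner_zero_right, inner_projOn, if_neg]
    simp only [Set.mem_ofPred_eq, not_le]
    exact ht.trans_le (Nat.cast_nonneg _)
  tendsto_atTop f := by
    classical
    rw [tendsto_iff_norm_sub_tendsto_zero]
    -- By Parseval the error is the tail of a convergent series, which tends to zero by dominated
    -- convergence.
    have hs : ∀ t : ℝ, ‖projOn b {i | (d i : ℝ) ≤ t} f - f‖ ^ 2 =
        ∑' i, if (d i : ℝ) ≤ t then 0 else ‖inner ℂ (b i) f‖ ^ 2 := by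
      intro t
      rw [← (hasSum_sq_norm_inner b _).tsum_eq]
      refine tsum_congr fun i => ?_
      rw [inner_sub_right, inner_projOn]
      simp only [Set.mem_ofPred_eq]
      split_ifs <;> simp
    have h0 : Tendsto (fun t : ℝ => ‖projOn b {i | (d i : ℝ) ≤ t} f - f‖ ^ 2) atTop (𝓝 0) := by
      simp_rw [hs]
      have := tendsto_tsum_of_dominated_convergence (𝓕 := (atTop : Filter ℝ))
        (f := fun t i => if (d i : ℝ) ≤ t then 0 else ‖inner ℂ (b i) f‖ ^ 2)
        (g := fun _ => (0 : ℝ)) (hasSum_sq_norm_inner b f).summable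
        (fun i => (tendsto_const_nhds).congr' (by
          filter_upwards [eventually_ge_atTop (d i : ℝ)] with t ht
          rw [if_pos ht]))
        (Eventually.of_forall fun t i => by
          split_ifs
          · rw [norm_zero]; positivity
          · rw [Real.norm_of_nonneg (by positivity)])
      simpa using this
    have := (Real.continuous_sqrt.tendsto 0).comp h0
    simpa [Function.comp_def, Real.sqrt_sq] using this

theorem ofEigenbasis_proj (b : HilbertBasis ι ℂ H) (d : ι → ℕ) (t : ℝ) :
    (ofEigenbasis b d).proj t = projOn b {i | (d i : ℝ) ≤ t} := rfl

/-- By Parseval for the projection, both measures give `(-∞, t]` the mass `∑ |⟨b_i, f⟩|²` over `d i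
≤ t`, and half-lines determine a finite measure. Integrals against the spectral measure thereby
become sums over the basis. -/
theorem spectralMeasure_ofEigenbasis (b : HilbertBasis ι ℂ H) (d : ι → ℕ) (f : H) :
    (ofEigenbasis b d).spectralMeasure f = Measure.sum fun i =>
      ENNReal.ofReal (‖inner ℂ (b i) f‖ ^ 2) • Measure.dirac (d i : ℝ) := by
  classical
  refine Measure.ext_of_Iic _ _ fun t => ?_
  have h := hasSum_sq_norm_projOn b {i | (d i : ℝ) ≤ t} f
  rw [spectralMeasure_Iic, ofEigenbasis_proj, Measure.sum_apply _ measurableSet_Iic, ← h.tsum_eq,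
    ENNReal.ofReal_tsum_of_nonneg _ h.summable]
  · refine tsum_congr fun i => ?_
    rw [Measure.smul_apply, Measure.dirac_apply' _ measurableSet_Iic]
    simp only [Set.mem_ofPred_eq, Set.indicator_apply, Set.mem_Iic, Pi.one_apply, smul_eq_mul]
    split_ifs <;> simp
  · intro i
    split_ifs <;> positivity

theorem integrable_sq_ofEigenbasis_iff (b : HilbertBasis ι ℂ H) (d : ι → ℕ) (f : H) :
    Integrable (fun t : ℝ => t ^ 2) ((ofEigenbasis b d).spectralMeasure f) ↔
      Summable fun i => ‖(d i : ℂ) * inner ℂ (b i) f‖ ^ 2 := by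
  have hm : AEStronglyMeasurable (fun t : ℝ => t ^ 2) ((ofEigenbasis b d).spectralMeasure f) :=
    (continuous_pow 2).aestronglyMeasurable
  have hl : ∫⁻ t : ℝ, ‖t ^ 2‖ₑ ∂((ofEigenbasis b d).spectralMeasure f) =
      ∑' i, ENNReal.ofReal (‖(d i : ℂ) * inner ℂ (b i) f‖ ^ 2) := by
    rw [spectralMeasure_ofEigenbasis, lintegral_sum_measure]
    refine tsum_congr fun i => ?_
    rw [lintegral_smul_measure, lintegral_dirac, Real.enorm_of_nonneg (by positivity), smul_eq_mul,
      ← ENNReal.ofReal_mul (by positivity)]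
    congr 1
    rw [norm_mul, mul_pow, mul_comm, Complex.norm_natCast]
  rw [Integrable, and_iff_right hm, HasFiniteIntegral, hl, lt_top_iff_ne_top]
  constructor
  · intro h
    have := ENNReal.summable_toReal h
    refine this.congr fun i => ?_
    rw [ENNReal.toReal_ofReal (by positivity)]
  · intro h
    rw [← ENNReal.ofReal_tsum_of_nonneg (fun i => by positivity) h]
    exact ENNReal.ofReal_ne_top

theorem hasSum_integral_ofEigenbasis (b : HilbertBasis ι ℂ H) (d : ι → ℕ) (f : H) (g : ℝ → ℝ)
    (hg : Integrable g ((ofEigenbasis b d).spectralMeasure f)) :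
    HasSum (fun i => ‖inner ℂ (b i) f‖ ^ 2 * g (d i))
      (∫ t, g t ∂((ofEigenbasis b d).spectralMeasure f)) := by
  rw [spectralMeasure_ofEigenbasis] at hg ⊢
  refine HasSum.congr_term (hasSum_integral_measure hg) fun i => ?_
  rw [integral_smul_measure, integral_dirac, ENNReal.toReal_ofReal (by positivity), smul_eq_mul]

/-- The hypothesis makes `T` the maximal diagonal operator. By Riesz–Fischer its domain consists of
the `f` for which the numbers `d i * ⟨b_i, f⟩` are square summable, which is finiteness of the
second spectral moment. -/
theorem ofEigenbasis_decomposes (b : HilbertBasis ι ℂ H) (d : ι → ℕ) (T : H →ₗ.[ℂ] H)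
    (hT : ∀ x y, (x, y) ∈ T.graph ↔ ∀ i, inner ℂ (b i) y = (d i : ℂ) * inner ℂ (b i) x) :
    (ofEigenbasis b d).Decomposes T := by
  have hgr : ∀ f : T.domain, ∀ i, inner ℂ (b i) (T f) = (d i : ℂ) * inner ℂ (b i) (f : H) :=
    fun f => (hT f (T f)).1 (T.mem_graph f)
  have hdom : ∀ f, f ∈ T.domain ↔
      Integrable (fun t : ℝ => t ^ 2) ((ofEigenbasis b d).spectralMeasure f) := by
    intro f
    rw [integrable_sq_ofEigenbasis_iff]
    constructor
    · intro hf
      have := (hasSum_sq_norm_inner b (T ⟨f, hf⟩)).summable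
      simpa only [hgr] using this
    · intro hs
      obtain ⟨y, hy⟩ := exists_inner_eq b _ hs
      exact LinearPMap.mem_domain_of_mem_graph ((hT f y).2 hy)
  refine ⟨hdom, fun f => ?_, fun f => ?_⟩
  · have h1 := hasSum_integral_ofEigenbasis b d (f : H) (fun t => t)
      (integrable_id_of_sq ((hdom f).1 f.2))
    have h2 : HasSum (fun i => ((‖inner ℂ (b i) (f : H)‖ ^ 2 * (d i : ℝ) : ℝ) : ℂ))
        ((∫ t, t ∂((ofEigenbasis b d).spectralMeasure (f : H)) : ℝ) : ℂ) := by
      exact_mod_cast h1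
    refine HasSum.unique ?_ h2
    refine HasSum.congr_term (b.hasSum_inner_mul_inner (T f) (f : H)) fun i => ?_
    rw [← inner_conj_symm (T f) (b i), hgr, map_mul, mul_assoc, RCLike.conj_mul, Complex.conj_natCast]
    push_cast
    rw [mul_comm]
    rfl
  · have h1 := hasSum_integral_ofEigenbasis b d (f : H) (fun t => t ^ 2) ((hdom f).1 f.2)
    refine HasSum.unique ?_ h1
    convert hasSum_sq_norm_inner b (T f) using 2 with i
    rw [hgr, norm_mul, mul_pow, mul_comm, Complex.norm_natCast]

end SpectralFamily

local notation "conj" => starRingEnd ℂ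

/-! ### Wirtinger derivatives in one variable -/

/-- `f` is real differentiable at `w` with `∂f/∂z = f₁` and `∂f/∂z̄ = f₂`. -/
def HasWirtinger (f : ℂ → ℂ) (f₁ f₂ w : ℂ) : Prop :=
  HasFDerivAt f (f₁ • ContinuousLinearMap.id ℝ ℂ +
    f₂ • (Complex.conjCLE : ℂ ≃L[ℝ] ℂ).toContinuousLinearMap) w

namespace HasWirtinger

variable {f g : ℂ → ℂ} {f₁ f₂ g₁ g₂ w : ℂ}

theorem of_eq (h : HasWirtinger f g₁ g₂ w) (h₁ : g₁ = f₁) (h₂ : g₂ = f₂) :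
    HasWirtinger f f₁ f₂ w := h₁ ▸ h₂ ▸ h

theorem fderiv_apply (h : HasWirtinger f f₁ f₂ w) (v : ℂ) :
    fderiv ℝ f w v = f₁ * v + f₂ * conj v := by
  rw [HasFDerivAt.fderiv h]
  simp

theorem add (hf : HasWirtinger f f₁ f₂ w) (hg : HasWirtinger g g₁ g₂ w) :
    HasWirtinger (fun w => f w + g w) (f₁ + g₁) (f₂ + g₂) w := by
  refine (HasFDerivAt.add hf hg).congr_fderiv ?_
  ext v
  simp
  ring

theorem mul (hf : HasWirtinger f f₁ f₂ w) (hg : HasWirtinger g g₁ g₂ w) :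
    HasWirtinger (fun w => f w * g w) (f₁ * g w + f w * g₁) (f₂ * g w + f w * g₂) w := by
  refine (HasFDerivAt.mul hf hg).congr_fderiv ?_
  ext v
  simp
  ring

theorem conjugate (hf : HasWirtinger f f₁ f₂ w) :
    HasWirtinger (fun w => conj (f w)) (conj f₂) (conj f₁) w := by
  refine ((Complex.conjCLE : ℂ ≃L[ℝ] ℂ).hasFDerivAt.comp w hf).congr_fderiv ?_
  ext v
  simp
  ring

theorem comp_hasDerivAt {g : ℂ → ℂ} {g' : ℂ} (hg : HasDerivAt g g' (f w))
    (hf : HasWirtinger f f₁ f₂ w) : HasWirtinger (fun w => g (f w)) (g' * f₁) (g' * f₂) w := by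
  refine ((hg.hasFDerivAt.restrictScalars ℝ).comp w hf).congr_fderiv ?_
  ext v
  simp
  ring

theorem of_hasDerivAt {f' : ℂ} (h : HasDerivAt f f' w) : HasWirtinger f f' 0 w := by
  refine (h.hasFDerivAt.restrictScalars ℝ).congr_fderiv ?_
  ext v
  simp [mul_comm]

end HasWirtinger

theorem hasWirtinger_const (c w : ℂ) : HasWirtinger (fun _ => c) 0 0 w :=
  .of_hasDerivAt (hasDerivAt_const w c)

theorem hasWirtinger_id (w : ℂ) : HasWirtinger (fun w => w) 1 0 w :=
  .of_hasDerivAt (hasDerivAt_id w)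

theorem hasWirtinger_conj (w : ℂ) : HasWirtinger (fun w => conj w) 0 1 w := by
  simpa using (hasWirtinger_id w).conjugate

/-! ### Functions of at most exponential growth -/

/-- Continuous functions of at most exponential growth. -/
def Tame (f : ℂ → ℂ) : Prop :=
  Continuous f ∧ ∃ C c : ℝ, 0 ≤ C ∧ 0 ≤ c ∧ ∀ w, ‖f w‖ ≤ C * Real.exp (c * ‖w‖)

namespace Tame

variable {f g : ℂ → ℂ}

theorem mul (hf : Tame f) (hg : Tame g) : Tame fun w => f w * g w := by
  obtain ⟨hfc, C, c, hC, hc, hf⟩ := hf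
  obtain ⟨hgc, D, d, hD, hd, hg⟩ := hg
  refine ⟨hfc.mul hgc, C * D, c + d, by positivity, by positivity, fun w => ?_⟩
  rw [norm_mul, add_mul, Real.exp_add]
  calc ‖f w‖ * ‖g w‖ ≤ (C * Real.exp (c * ‖w‖)) * (D * Real.exp (d * ‖w‖)) := by
        gcongr
        exacts [hf w, hg w]
    _ = _ := by ring

theorem add (hf : Tame f) (hg : Tame g) : Tame fun w => f w + g w := by
  obtain ⟨hfc, C, c, hC, hc, hf⟩ := hf
  obtain ⟨hgc, D, d, hD, hd, hg⟩ := hg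
  refine ⟨hfc.add hgc, C + D, c + d, by positivity, by positivity, fun w => ?_⟩
  calc ‖f w + g w‖ ≤ ‖f w‖ + ‖g w‖ := norm_add_le _ _
    _ ≤ C * Real.exp (c * ‖w‖) + D * Real.exp (d * ‖w‖) := add_le_add (hf w) (hg w)
    _ ≤ C * Real.exp ((c + d) * ‖w‖) + D * Real.exp ((c + d) * ‖w‖) := by
        gcongr <;> linarith
    _ = _ := by ring

theorem const (a : ℂ) : Tame fun _ => a :=
  ⟨continuous_const, ‖a‖, 0, norm_nonneg _, le_rfl, fun w => by simp⟩

theorem id : Tame fun w => w :=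
  ⟨continuous_id, 1, 1, zero_le_one, zero_le_one, fun w => by
    rw [one_mul, one_mul]; linarith [Real.add_one_le_exp ‖w‖]⟩

theorem conjugate (hf : Tame f) : Tame fun w => conj (f w) := by
  obtain ⟨hfc, C, c, hC, hc, hf⟩ := hf
  exact ⟨Complex.continuous_conj.comp hfc, C, c, hC, hc, fun w => by
    rw [RCLike.norm_conj]; exact hf w⟩

theorem exp (a : ℂ) : Tame fun w => Complex.exp (a * w) := by
  refine ⟨by fun_prop, 1, ‖a‖, zero_le_one, norm_nonneg _, fun w => ?_⟩
  rw [one_mul, Complex.norm_exp, ← norm_mul]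
  exact Real.exp_le_exp.2 (Complex.re_le_norm _)

theorem sub (hf : Tame f) (hg : Tame g) : Tame fun w => f w - g w := by
  have := hf.add ((const (-1)).mul hg)
  simpa [sub_eq_add_neg] using this

theorem pow (hf : Tame f) (k : ℕ) : Tame fun w => f w ^ k := by
  induction k with
  | zero => simpa using const 1
  | succ k ih => simpa [pow_succ] using ih.mul hf

theorem comp_sub (hf : Tame f) (z : ℂ) : Tame fun w => f (w - z) := by
  obtain ⟨hfc, C, c, hC, hc, hf⟩ := hf
  refine ⟨by fun_prop, C * Real.exp (c * ‖z‖), c, by positivity, hc, fun w => (hf _).trans ?_⟩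
  rw [mul_assoc, ← Real.exp_add, ← mul_add, add_comm ‖z‖]
  gcongr
  exact norm_sub_le _ _

end Tame

/-! ### Gaussian integrals in one variable -/

/-- The Gaussian weight `e^{-|w|²}` on `ℂ`. -/
def weight (w : ℂ) : ℝ := Real.exp (-‖w‖ ^ 2)

theorem weight_pos (w : ℂ) : 0 < weight w := Real.exp_pos _

theorem continuous_weight : Continuous weight := by unfold weight; fun_prop

theorem integrable_exp_mul_weight (C c : ℝ) :
    Integrable fun w : ℂ => C * Real.exp (c * ‖w‖) * weight w := by
  have h := (GaussianFourier.integrable_cexp_neg_mul_sq_norm_add (V := ℂ) (b := 1 / 2)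
    (by norm_num) 0 0).norm
  -- From `(c - r)² ≥ 0` one has `c r - r² ≤ c²/2 - r²/2`, so half of the Gaussian absorbs the
  -- exponential.
  have h2 : Integrable fun w : ℂ => |C| * Real.exp (c ^ 2 / 2) * Real.exp (-(‖w‖ ^ 2 / 2)) := by
    refine (h.const_mul (|C| * Real.exp (c ^ 2 / 2))).congr (Eventually.of_forall fun w => ?_)
    simp only [Complex.norm_exp]
    congr 2
    simp [← Complex.ofReal_pow]
    ring
  refine h2.mono' ?_ (Eventually.of_forall fun w => ?_)
  · exact Continuous.aestronglyMeasurable (by have := continuous_weight; fun_prop)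
  · rw [norm_mul, norm_mul, Real.norm_eq_abs, Real.norm_of_nonneg (Real.exp_pos _).le,
      Real.norm_of_nonneg (weight_pos w).le, weight, mul_assoc, mul_assoc, ← Real.exp_add,
      ← Real.exp_add]
    refine mul_le_mul_of_nonneg_left (Real.exp_le_exp.2 ?_) (abs_nonneg _)
    nlinarith [sq_nonneg (c - ‖w‖)]

theorem Tame.integrable {f : ℂ → ℂ} (hf : Tame f) : Integrable fun w => f w * (weight w : ℂ) := by
  obtain ⟨hfc, C, c, hC, hc, hf⟩ := hf
  refine (integrable_exp_mul_weight C c).mono' ?_ (Eventually.of_forall fun w => ?_)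
  · exact Continuous.aestronglyMeasurable (by have := continuous_weight; fun_prop)
  · rw [norm_mul, Complex.norm_real, Real.norm_of_nonneg (weight_pos w).le]
    exact mul_le_mul_of_nonneg_right (hf w) (weight_pos w).le

/-- The integral of `f` against `e^{-|w|²} dμ(w)` on `ℂ`. -/
def gint (f : ℂ → ℂ) : ℂ := ∫ w, f w * (weight w : ℂ)

theorem gint_add {f g : ℂ → ℂ} (hf : Tame f) (hg : Tame g) :
    gint (fun w => f w + g w) = gint f + gint g := by
  rw [gint, gint, gint, ← integral_add hf.integrable hg.integrable]
  simp only [add_mul]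

theorem gint_sub {f g : ℂ → ℂ} (hf : Tame f) (hg : Tame g) :
    gint (fun w => f w - g w) = gint f - gint g := by
  rw [gint, gint, gint, ← integral_sub hf.integrable hg.integrable]
  simp only [sub_mul]

theorem gint_const_mul (c : ℂ) (f : ℂ → ℂ) : gint (fun w => c * f w) = c * gint f := by
  rw [gint, gint, ← integral_const_mul]
  simp only [mul_assoc]

theorem hasWirtinger_weight (w : ℂ) :
    HasWirtinger (fun w => (weight w : ℂ)) (-conj w * weight w) (-w * weight w) w := by
  have h : (fun w => (weight w : ℂ)) = fun w => Complex.exp ((-1) * (w * conj w)) := by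
    funext w
    rw [weight, Complex.ofReal_exp, Complex.mul_conj']
    push_cast
    ring_nf
  have h2 : (weight w : ℂ) = Complex.exp ((-1) * (w * conj w)) := congrFun h w
  rw [h2, h]
  refine (HasWirtinger.comp_hasDerivAt (Complex.hasDerivAt_exp _)
    ((hasWirtinger_const (-1) w).mul ((hasWirtinger_id w).mul (hasWirtinger_conj w)))).of_eq ?_ ?_
  · ring
  · ring

/-- Integration by parts against the constant function 1, whose derivative vanishes; integrability
of `F` and of its directional derivative replaces compact support. -/
theorem integral_fderiv_eq_zero {E : Type*} [NormedAddCommGroup E] [NormedSpace ℝ E]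
    [FiniteDimensional ℝ E] [MeasurableSpace E] [BorelSpace E] {μ : Measure E} [μ.IsAddHaarMeasure]
    {F : E → ℂ} {F' : E → E →L[ℝ] ℂ} (hF : ∀ w, HasFDerivAt F (F' w) w) (v : E)
    (hi : Integrable F μ) (hi' : Integrable (fun w => F' w v) μ) : ∫ w, F' w v ∂μ = 0 := by
  have h := integral_bilinear_hasFDerivAt_right_eq_neg_left_of_integrable (μ := μ) (f := fun _ => (1 : ℂ))
    (f' := fun _ => 0) (g := F) (g' := F') (v := v) (B := ContinuousLinearMap.mul ℝ ℂ)
    (by simp) (by simpa using hi') (by simpa using hi)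
    (fun x _ => hasFDerivAt_const _ _) (fun x _ => hF x)
  simpa using h

/-- Integration by parts against the Gaussian weight. -/
theorem gint_parts {f f₁ f₂ : ℂ → ℂ} (hf : Tame f) (hf₁ : Tame f₁) (hf₂ : Tame f₂)
    (h : ∀ w, HasWirtinger f (f₁ w) (f₂ w) w) :
    gint (fun w => f₁ w - conj w * f w) = 0 ∧ gint (fun w => f₂ w - w * f w) = 0 := by
  have t₁ : Tame fun w => f₁ w - conj w * f w := hf₁.sub (Tame.id.conjugate.mul hf)
  have t₂ : Tame fun w => f₂ w - w * f w := hf₂.sub (Tame.id.mul hf)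
  have hd : ∀ w, HasWirtinger (fun w => f w * (weight w : ℂ)) ((f₁ w - conj w * f w) * weight w)
      ((f₂ w - w * f w) * weight w) w := fun w =>
    ((h w).mul (hasWirtinger_weight w)).of_eq (by ring) (by ring)
  have i1 := t₁.integrable
  have i2 := t₂.integrable
  -- The derivative in a real direction `v` integrates to a combination of `v` and `conj v`; the
  -- directions 1 and `I` separate the two Wirtinger parts.
  have key : ∀ v : ℂ, gint (fun w => f₁ w - conj w * f w) * v +
      gint (fun w => f₂ w - w * f w) * conj v = 0 := by
    intro v
    have := integral_fderiv_eq_zero (μ := (volume : Measure ℂ)) hd v hf.integrable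
      (((i1.mul_const v).add (i2.mul_const (conj v))).congr (Eventually.of_forall fun w => by simp))
    simp only [add_apply, smul_apply,
      ContinuousLinearMap.id_apply, smul_eq_mul, ContinuousLinearEquiv.coe_coe,
      Complex.conjCLE_apply] at this
    rw [integral_add (i1.mul_const v) (i2.mul_const (conj v)), integral_mul_const,
      integral_mul_const] at this
    exact this
  have k1 := key 1
  have k2 := key Complex.I
  simp only [map_one, mul_one, Complex.conj_I] at k1 k2
  have k3 : gint (fun w => f₁ w - conj w * f w) - gint (fun w => f₂ w - w * f w) = 0 := by
    have := congrArg (· * (-Complex.I)) k2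
    simp only [zero_mul] at this
    linear_combination this + (gint (fun w => f₁ w - conj w * f w) -
      gint (fun w => f₂ w - w * f w)) * Complex.I_sq
  constructor
  · linear_combination (k1 + k3) / 2
  · linear_combination (k1 - k3) / 2

theorem gint_exp (α β : ℂ) :
    gint (fun w => Complex.exp (α * conj w) * Complex.exp (β * w)) =
      Real.pi * Complex.exp (α * β) := by
  have hr : ∀ c : ℂ, ∫ x : ℝ, Complex.exp (-1 * (x : ℂ) ^ 2 + c * x + 0) =
      (Real.pi : ℂ) ^ (1 / 2 : ℂ) * Complex.exp (c ^ 2 / 4) := by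
    intro c
    rw [integral_cexp_quadratic (by norm_num)]
    congr 2
    · norm_num
    · ring
  rw [gint, ← (Complex.volume_preserving_equiv_real_prod.symm).integral_comp
    Complex.measurableEquivRealProd.symm.measurableEmbedding]
  -- In real coordinates the exponent splits into `-x² + (α + β)x` and `-y² + i(β - α)y`, and `(α +
  -- β)²/4 - (β - α)²/4 = αβ`.
  have h : ∀ p : ℝ × ℝ, (Complex.exp (α * conj (Complex.measurableEquivRealProd.symm p)) *
      Complex.exp (β * Complex.measurableEquivRealProd.symm p)) *
      (weight (Complex.measurableEquivRealProd.symm p) : ℂ) =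
      Complex.exp (-1 * (p.1 : ℂ) ^ 2 + (α + β) * p.1 + 0) *
      Complex.exp (-1 * (p.2 : ℂ) ^ 2 + (Complex.I * (β - α)) * p.2 + 0) := by
    rintro ⟨x, y⟩
    have e : Complex.measurableEquivRealProd.symm (x, y) = x + y * Complex.I := by
      apply Complex.ext <;> simp [Complex.measurableEquivRealProd_symm_apply]
    rw [e, weight, Complex.sq_norm, Complex.normSq_add_mul_I, Complex.ofReal_exp,
      ← Complex.exp_add, ← Complex.exp_add, ← Complex.exp_add]
    congr 1
    simp only [map_add, map_mul, Complex.conj_ofReal, Complex.conj_I]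
    push_cast
    ring
  simp_rw [h]
  rw [Measure.volume_eq_prod, integral_prod_mul (μ := (volume : Measure ℝ)) (ν := (volume : Measure ℝ))
    (fun x : ℝ => Complex.exp (-1 * (x : ℂ) ^ 2 + (α + β) * x + 0))
    (fun y : ℝ => Complex.exp (-1 * (y : ℂ) ^ 2 + (Complex.I * (β - α)) * y + 0)), hr, hr,
    mul_mul_mul_comm, ← Complex.cpow_add _ _ (by exact_mod_cast Real.pi_ne_zero), ← Complex.exp_add]
  congr 1
  · norm_num
  · congr 1
    linear_combination ((β - α) ^ 2 / 4) * Complex.I_sq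

/-! ### Complex Hermite polynomials -/

/-- The complex Hermite polynomial `(-∂/∂z + z̄)^q z^p`. -/
def cHermite : ℕ → ℕ → ℂ → ℂ
  | 0, p, w => w ^ p
  | q + 1, p, w => conj w * cHermite q p w - p * cHermite q (p - 1) w

theorem cHermite_succ (q p : ℕ) (w : ℂ) :
    cHermite (q + 1) p w = conj w * cHermite q p w - p * cHermite q (p - 1) w := rfl

/-- `∂/∂z` commutes with `-∂/∂z + z̄`, while `∂/∂z̄` has commutator 1 with it, so each derivative
lowers one index. The truncated `p - 1` and `q - 1` are harmless, since the factors `p` and `q`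
vanish there. -/
theorem hasWirtinger_cHermite (q p : ℕ) (w : ℂ) :
    HasWirtinger (cHermite q p) (p * cHermite q (p - 1) w) (q * cHermite (q - 1) p w) w := by
  induction q generalizing p with
  | zero =>
    refine (HasWirtinger.of_hasDerivAt (hasDerivAt_pow p w)).of_eq ?_ ?_
    · rfl
    · simp
  | succ q ih =>
    have h : cHermite (q + 1) p =
        fun w => conj w * cHermite q p w + (-p : ℂ) * cHermite q (p - 1) w := by
      funext w; rw [cHermite_succ]; ring
    rw [h]
    refine (((hasWirtinger_conj w).mul (ih p)).add
      ((hasWirtinger_const (-p : ℂ) w).mul (ih (p - 1)))).of_eq ?_ ?_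
    · rw [cHermite_succ]; ring
    · cases q with
      | zero => simp
      | succ q =>
        simp only [Nat.add_sub_cancel, cHermite_succ q]
        push_cast
        ring

/-- The commutator of multiplication by `z` with `-∂/∂z + z̄` is 1. Together with the rule for `z̄`,
this makes the span of the Hermite functions stable under multiplication by polynomials. -/
theorem mul_cHermite (q p : ℕ) (w : ℂ) :
    w * cHermite q p w = cHermite q (p + 1) w + q * cHermite (q - 1) p w := by
  induction q generalizing p with
  | zero => simp [cHermite, pow_succ, mul_comm]
  | succ q ih =>
    have h1 : (p : ℂ) * (w * cHermite q (p - 1) w) =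
        p * cHermite q p w + p * (q * cHermite (q - 1) (p - 1) w) := by
      cases p with
      | zero => simp
      | succ p => rw [ih]; simp only [Nat.add_sub_cancel]; ring
    have h2 : (q : ℂ) * cHermite q p w =
        q * (conj w * cHermite (q - 1) p w - p * cHermite (q - 1) (p - 1) w) := by
      cases q with
      | zero => simp
      | succ q => rw [cHermite_succ, Nat.add_sub_cancel]
    rw [cHermite_succ q (p + 1), Nat.add_sub_cancel, Nat.add_sub_cancel, cHermite_succ q p]
    push_cast
    linear_combination conj w * ih p - h1 - h2

theorem conj_mul_cHermite (q p : ℕ) (w : ℂ) :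
    conj w * cHermite q p w = cHermite (q + 1) p w + p * cHermite q (p - 1) w := by
  rw [cHermite_succ]; ring

/-- At the origin the recursion keeps only the term that lowers `p`. This value enters both the
norms of the Hermite functions and the diagonal of the level kernels. -/
theorem cHermite_apply_zero (q p : ℕ) :
    cHermite q p 0 = if q = p then (-1) ^ q * (q.factorial : ℂ) else 0 := by
  induction q generalizing p with
  | zero => cases p <;> simp [cHermite]
  | succ q ih =>
    rw [cHermite_succ, map_zero, zero_mul, zero_sub, ih]
    cases p with
    | zero => simp
    | succ p =>
      simp only [Nat.add_sub_cancel, Nat.add_right_cancel_iff]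
      split_ifs with h
      · subst h
        rw [Nat.factorial_succ]; push_cast; ring
      · simp

theorem tame_cHermite (q p : ℕ) : Tame (cHermite q p) := by
  induction q generalizing p with
  | zero => exact Tame.id.pow p
  | succ q ih => exact (Tame.id.conjugate.mul (ih p)).sub ((Tame.const _).mul (ih _))

theorem continuous_cHermite (q p : ℕ) : Continuous (cHermite q p) := (tame_cHermite q p).1

/-! ### Magnetic translates and their inner products -/

/-- The image of a complex Hermite polynomial under the magnetic translation by `z`, up to a
scalar. -/
def shifted (z : ℂ) (q p : ℕ) (w : ℂ) : ℂ := Complex.exp (conj z * w) * cHermite q p (w - z)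

theorem tame_shifted (z : ℂ) (q p : ℕ) : Tame (shifted z q p) :=
  (Tame.exp _).mul ((tame_cHermite q p).comp_sub z)

theorem shifted_zero (q p : ℕ) : shifted 0 q p = cHermite q p := by
  funext w; simp [shifted]

theorem hasWirtinger_exp_mul (a w : ℂ) :
    HasWirtinger (fun w => Complex.exp (a * w)) (a * Complex.exp (a * w)) 0 w := by
  refine .of_hasDerivAt ?_
  have := ((hasDerivAt_id w).const_mul a).cexp
  simpa [mul_comm] using this

theorem hasWirtinger_sub_const (z w : ℂ) : HasWirtinger (fun w => w - z) 1 0 w :=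
  .of_hasDerivAt ((hasDerivAt_id w).sub_const z)

/-- The magnetic translation commutes with `∂/∂z̄` and with `-∂/∂z + z̄`, so the translates obey the
same ladder relations in `q`. -/
theorem hasWirtinger_shifted (z : ℂ) (q p : ℕ) (w : ℂ) :
    HasWirtinger (shifted z q p) (conj w * shifted z q p w - shifted z (q + 1) p w)
      (q * shifted z (q - 1) p w) w := by
  have h : HasWirtinger (fun w => cHermite q p (w - z)) (p * cHermite q (p - 1) (w - z))
      (q * cHermite (q - 1) p (w - z)) w := by
    refine HasFDerivAt.congr_fderiv (HasFDerivAt.comp (g := cHermite q p) (f := fun w => w - z) w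
      (hasWirtinger_cHermite q p (w - z)) (hasWirtinger_sub_const z w)) ?_
    ext v
    simp
  refine ((hasWirtinger_exp_mul (conj z) w).mul h).of_eq ?_ ?_
  · simp only [shifted, cHermite_succ, map_sub]; ring
  · simp only [shifted]; ring

/-- The raising operator is the adjoint of `∂/∂z̄`, which lowers the index of the other factor. The
centres `z` and `u` may differ because both operators commute with magnetic translations. -/
theorem gint_conj_shifted_mul_succ (z u : ℂ) (q a r p : ℕ) :
    gint (fun w => conj (shifted z q a w) * shifted u (r + 1) p w) =
      q * gint (fun w => conj (shifted z (q - 1) a w) * shifted u r p w) := by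
  have ht := fun q a => tame_shifted z q a
  have hu := fun q a => tame_shifted u q a
  have h := (gint_parts ((ht q a).conjugate.mul (hu r p))
    (f₁ := fun w => conj (q * shifted z (q - 1) a w) * shifted u r p w + conj (shifted z q a w) *
      (conj w * shifted u r p w - shifted u (r + 1) p w))
    (f₂ := fun w => conj (conj w * shifted z q a w - shifted z (q + 1) a w) * shifted u r p w +
      conj (shifted z q a w) * (r * shifted u (r - 1) p w))
    ((((Tame.const _).mul (ht _ _)).conjugate.mul (hu _ _)).add ((ht _ _).conjugate.mul
      ((Tame.id.conjugate.mul (hu _ _)).sub (hu _ _))))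
    ((((Tame.id.conjugate.mul (ht _ _)).sub (ht _ _)).conjugate.mul (hu _ _)).add ((ht _ _).conjugate.mul
      ((Tame.const _).mul (hu _ _))))
    (fun w => (hasWirtinger_shifted z q a w).conjugate.mul (hasWirtinger_shifted u r p w))).1
  have h2 : gint (fun w => q * (conj (shifted z (q - 1) a w) * shifted u r p w) -
      conj (shifted z q a w) * shifted u (r + 1) p w) = 0 := by
    rw [← h]
    congr 1
    funext w
    simp only [map_mul, Complex.conj_natCast]
    ring
  rw [gint_sub ((Tame.const _).mul ((ht _ _).conjugate.mul (hu _ _))) ((ht _ _).conjugate.mul (hu _ _)),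
    gint_const_mul] at h2
  exact (sub_eq_zero.1 h2).symm

theorem gint_conj (f : ℂ → ℂ) : gint (fun w => conj (f w)) = conj (gint f) := by
  rw [gint, gint, ← integral_conj]
  simp only [map_mul, Complex.conj_ofReal]

theorem gint_conj_shifted_succ_mul (z u : ℂ) (q a r p : ℕ) :
    gint (fun w => conj (shifted z (q + 1) a w) * shifted u r p w) =
      r * gint (fun w => conj (shifted z q a w) * shifted u (r - 1) p w) := by
  have h := congrArg conj (gint_conj_shifted_mul_succ u z r p q a)
  rw [map_mul, ← gint_conj, ← gint_conj, Complex.conj_natCast] at h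
  simp only [map_mul, Complex.conj_conj] at h
  simp only [mul_comm (conj _) (shifted _ _ _ _)]
  exact h

/-- Moving the raising operators across one at a time shows that different levels are orthogonal
whatever the centres, and reduces equal levels to the holomorphic case at the cost of `q!`. -/
theorem gint_conj_shifted_mul_shifted (z u : ℂ) (q a r p : ℕ) :
    gint (fun w => conj (shifted z q a w) * shifted u r p w) =
      if q = r then q.factorial * gint (fun w => conj (shifted z 0 a w) * shifted u 0 p w)
      else 0 := by
  induction q generalizing r with
  | zero =>
    cases r with
    | zero => simp
    | succ r => rw [gint_conj_shifted_mul_succ]; simp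
  | succ q ih =>
    rw [gint_conj_shifted_succ_mul]
    cases r with
    | zero => simp
    | succ r =>
      rw [Nat.add_sub_cancel, ih]
      simp only [Nat.add_right_cancel_iff]
      split_ifs with h
      · subst h
        rw [Nat.factorial_succ]; push_cast; ring
      · simp

theorem shifted_zero_left (z : ℂ) (p : ℕ) (w : ℂ) :
    shifted z 0 p w = Complex.exp (conj z * w) * (w - z) ^ p := rfl

theorem hasWirtinger_shifted_zero_left (z : ℂ) (p : ℕ) (w : ℂ) :
    HasWirtinger (shifted z 0 p) (conj z * shifted z 0 p w + p * shifted z 0 (p - 1) w) 0 w := by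
  refine (hasWirtinger_shifted z 0 p w).of_eq ?_ (by simp)
  simp only [shifted, cHermite_succ, map_sub]; ring

theorem conj_shifted_zero_succ (z : ℂ) (a : ℕ) (w : ℂ) :
    conj (shifted z 0 (a + 1) w) = conj w * conj (shifted z 0 a w) - conj z * conj (shifted z 0 a w) := by
  simp only [shifted_zero_left, pow_succ, map_mul, map_sub]; ring

/-- On holomorphic functions multiplication by `conj w` acts under the integral as `∂/∂w`, as in the
Bargmann–Fock space. Differentiating the exponential produces `conj u`, and the centre of the first
factor produces `conj z`. -/
theorem gint_conj_shifted_zero_succ (z u : ℂ) (a p : ℕ) :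
    gint (fun w => conj (shifted z 0 (a + 1) w) * shifted u 0 p w) =
      (conj u - conj z) * gint (fun w => conj (shifted z 0 a w) * shifted u 0 p w) +
      p * gint (fun w => conj (shifted z 0 a w) * shifted u 0 (p - 1) w) := by
  have ht := fun a => tame_shifted z 0 a
  have hu := fun a => tame_shifted u 0 a
  have h := (gint_parts ((ht a).conjugate.mul (hu p))
    (f₁ := fun w => conj 0 * shifted u 0 p w + conj (shifted z 0 a w) *
      (conj u * shifted u 0 p w + p * shifted u 0 (p - 1) w))
    (f₂ := fun w => conj (conj z * shifted z 0 a w + a * shifted z 0 (a - 1) w) * shifted u 0 p w +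
      conj (shifted z 0 a w) * 0)
    (((Tame.const _).mul (hu _)).add ((ht _).conjugate.mul
      (((Tame.const _).mul (hu _)).add ((Tame.const _).mul (hu _)))))
    (((((Tame.const _).mul (ht _)).add ((Tame.const _).mul (ht _))).conjugate.mul (hu _)).add
      ((ht _).conjugate.mul (Tame.const _)))
    (fun w => (hasWirtinger_shifted_zero_left z a w).conjugate.mul
      (hasWirtinger_shifted_zero_left u p w))).1
  have h2 : gint (fun w => ((conj u - conj z) * (conj (shifted z 0 a w) * shifted u 0 p w) +
      p * (conj (shifted z 0 a w) * shifted u 0 (p - 1) w)) -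
      conj (shifted z 0 (a + 1) w) * shifted u 0 p w) = 0 := by
    rw [← h]
    congr 1
    funext w
    rw [conj_shifted_zero_succ]
    simp only [map_zero]
    ring
  rw [gint_sub (((Tame.const _).mul ((ht _).conjugate.mul (hu _))).add
      ((Tame.const _).mul ((ht _).conjugate.mul (hu _)))) ((ht _).conjugate.mul (hu _)),
    gint_add ((Tame.const _).mul ((ht _).conjugate.mul (hu _)))
      ((Tame.const _).mul ((ht _).conjugate.mul (hu _))), gint_const_mul, gint_const_mul] at h2
  exact (sub_eq_zero.1 h2).symm

theorem gint_conj_shifted_zero_mul_succ (z u : ℂ) (a p : ℕ) :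
    gint (fun w => conj (shifted z 0 a w) * shifted u 0 (p + 1) w) =
      (z - u) * gint (fun w => conj (shifted z 0 a w) * shifted u 0 p w) +
      a * gint (fun w => conj (shifted z 0 (a - 1) w) * shifted u 0 p w) := by
  have h := congrArg conj (gint_conj_shifted_zero_succ u z p a)
  rw [map_add, map_mul, map_mul, ← gint_conj, ← gint_conj, ← gint_conj, Complex.conj_natCast] at h
  simp only [map_mul, map_sub, Complex.conj_conj] at h
  simp only [mul_comm (conj _) (shifted _ _ _ _)]
  exact h

theorem gint_conj_shifted_zero_zero (z u : ℂ) :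
    gint (fun w => conj (shifted z 0 0 w) * shifted u 0 0 w) =
      Real.pi * Complex.exp (z * conj u) := by
  rw [← gint_exp]
  congr 1
  funext w
  simp [shifted, cHermite, ← Complex.exp_conj]

/-- The projection of a monomial onto the holomorphic functions, shifted by `z`. -/
theorem gint_conj_shifted_mul_pow (z : ℂ) (a p : ℕ) :
    gint (fun w => conj (shifted z 0 a w) * shifted 0 0 p w) =
      Real.pi * ((-1) ^ a * cHermite a p z) := by
  induction a generalizing p with
  | zero =>
    induction p with
    | zero => rw [gint_conj_shifted_zero_zero]; simp [cHermite]
    | succ p ih =>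
      rw [gint_conj_shifted_zero_mul_succ, ih]
      simp only [cHermite, pow_succ]; push_cast; ring
  | succ a ih =>
    -- With second centre 0 this is the recursion that defines `cHermite`, with the opposite sign;
    -- hence the factor `(-1) ^ a`.
    rw [gint_conj_shifted_zero_succ, ih, ih, cHermite_succ, map_zero]
    ring

theorem gint_conj_cHermite_mul_cHermite (q p r s : ℕ) :
    gint (fun w => conj (cHermite q p w) * cHermite r s w) =
      if q = r ∧ p = s then Real.pi * (q.factorial * p.factorial) else 0 := by
  have h := gint_conj_shifted_mul_shifted 0 0 q p r s
  rw [shifted_zero, shifted_zero, gint_conj_shifted_mul_pow, cHermite_apply_zero] at h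
  rw [h]
  by_cases h1 : q = r <;> by_cases h2 : p = s <;> simp [h1, h2]
  have : ((-1 : ℂ) ^ s * (-1) ^ s) = 1 := by rw [← mul_pow]; simp
  linear_combination (Real.pi * (r.factorial : ℂ) * s.factorial) * this

theorem gint_conj_shifted_self (z : ℂ) (a p : ℕ) :
    gint (fun w => conj (shifted z 0 a w) * shifted z 0 p w) =
      if a = p then Real.pi * (a.factorial * Complex.exp (z * conj z)) else 0 := by
  induction a generalizing p with
  | zero =>
    cases p with
    | zero => rw [gint_conj_shifted_zero_zero]; simp
    | succ p => rw [gint_conj_shifted_zero_mul_succ]; simp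
  | succ a ih =>
    rw [gint_conj_shifted_zero_succ, ih, ih, sub_self, zero_mul, zero_add]
    cases p with
    | zero => simp
    | succ p =>
      simp only [Nat.add_sub_cancel, Nat.add_right_cancel_iff]
      split_ifs with h
      · subst h
        rw [Nat.factorial_succ]; push_cast; ring
      · simp

/-! ### The kernels of the Landau level projections in one variable -/

/-- The kernel of the projection onto the `q`-th Landau level. -/
def levelKernel (q : ℕ) (z w : ℂ) : ℂ :=
  (-1) ^ q / (Real.pi * q.factorial) * conj (shifted z q q w)

theorem tame_levelKernel (q : ℕ) (z : ℂ) : Tame (levelKernel q z) :=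
  (Tame.const _).mul (tame_shifted z q q).conjugate

theorem continuous_levelKernel (q : ℕ) :
    Continuous fun p : ℂ × ℂ => levelKernel q p.1 p.2 := by
  have h := continuous_cHermite q q
  have h2 := Complex.continuous_conj
  unfold levelKernel shifted
  fun_prop

theorem pi_mul_factorial_ne_zero (q : ℕ) : (Real.pi * q.factorial : ℂ) ≠ 0 :=
  mul_ne_zero (by exact_mod_cast Real.pi_ne_zero) (by exact_mod_cast q.factorial_ne_zero)

theorem neg_one_pow_mul_self (q : ℕ) : ((-1 : ℂ) ^ q * (-1) ^ q) = 1 := by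
  rw [← mul_pow]; simp

/-- The reproducing property, which fixes the constant in `levelKernel`: reduction to the
holomorphic case yields `q!`, and the translated monomial yields `π (-1)^q`. -/
theorem gint_levelKernel_mul_cHermite (q r p : ℕ) (z : ℂ) :
    gint (fun w => levelKernel q z w * cHermite r p w) = if q = r then cHermite r p z else 0 := by
  simp only [levelKernel, mul_assoc]
  rw [gint_const_mul, ← shifted_zero r p, gint_conj_shifted_mul_shifted, gint_conj_shifted_mul_pow,
    shifted_zero]
  split_ifs with h
  · subst h
    have := pi_mul_factorial_ne_zero q
    rw [div_mul_eq_mul_div, div_eq_iff this]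
    linear_combination (Real.pi * q.factorial * cHermite q p z) * neg_one_pow_mul_self q
  · simp

/-- On the diagonal the translate is evaluated at its centre, where the Hermite value `(-1)^q q!`
cancels the normalization. The result does not depend on `q`: all levels have the same density. -/
theorem levelKernel_self (q : ℕ) (z : ℂ) :
    levelKernel q z z = Complex.exp (z * conj z) / Real.pi := by
  have h1 : (q.factorial : ℂ) ≠ 0 := by exact_mod_cast q.factorial_ne_zero
  have h2 : (Real.pi : ℂ) ≠ 0 := by exact_mod_cast Real.pi_ne_zero
  rw [levelKernel, shifted, sub_self, cHermite_apply_zero, if_pos rfl]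
  simp only [map_mul, map_pow, map_neg, map_one, Complex.conj_natCast, ← Complex.exp_conj,
    Complex.conj_conj]
  field_simp
  linear_combination neg_one_pow_mul_self q

/-- The squared norm of the kernel equals its diagonal value, as it must for an orthogonal
projection; Parseval's identity for the kernel needs it in this form. -/
theorem gint_conj_levelKernel_mul_self (q : ℕ) (z : ℂ) :
    gint (fun w => conj (levelKernel q z w) * levelKernel q z w) =
      Complex.exp (z * conj z) / Real.pi := by
  have h1 : (q.factorial : ℂ) ≠ 0 := by exact_mod_cast q.factorial_ne_zero
  have h2 : (Real.pi : ℂ) ≠ 0 := by exact_mod_cast Real.pi_ne_zero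
  have h : (fun w => conj (levelKernel q z w) * levelKernel q z w) = fun w =>
      ((-1) ^ q / (Real.pi * q.factorial)) ^ 2 * (conj (shifted z q q w) * shifted z q q w) := by
    funext w
    simp only [levelKernel, map_mul, map_div₀, map_pow, map_neg, map_one, Complex.conj_natCast,
      Complex.conj_ofReal, Complex.conj_conj]
    ring
  rw [h, gint_const_mul, gint_conj_shifted_mul_shifted, if_pos rfl, gint_conj_shifted_self,
    if_pos rfl]
  field_simp
  linear_combination neg_one_pow_mul_self q

variable {n : ℕ}

/-! ### Integration against the Gaussian measure -/

theorem exp_neg_sqNorm (z : Cn n) : Real.exp (-sqNorm z) = ∏ j, weight (z j) := by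
  simp only [weight, sqNorm, ← Real.exp_sum, Finset.sum_neg_distrib]

theorem measurable_exp_neg_sqNorm :
    Measurable fun z : Cn n => Real.toNNReal (Real.exp (-sqNorm z)) :=
  (Real.continuous_exp.comp (continuous_sqNorm n).neg).measurable.real_toNNReal

theorem gaussianMeasure_eq : gaussianMeasure n =
    (volume : Measure (Cn n)).withDensity fun z => (Real.toNNReal (Real.exp (-sqNorm z)) : ENNReal) :=
  rfl

theorem integrable_gaussianMeasure_iff {f : Cn n → ℂ} :
    Integrable f (gaussianMeasure n) ↔
      Integrable fun z => f z * (Real.exp (-sqNorm z) : ℂ) := by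
  rw [gaussianMeasure_eq,
    integrable_withDensity_iff_integrable_coe_smul measurable_exp_neg_sqNorm]
  refine integrable_congr (Eventually.of_forall fun z => ?_)
  simp only [Real.coe_toNNReal _ (Real.exp_pos _).le, Complex.real_smul]
  rw [mul_comm]

theorem integral_gaussianMeasure (f : Cn n → ℂ) :
    ∫ z, f z ∂(gaussianMeasure n) = ∫ z, f z * (Real.exp (-sqNorm z) : ℂ) := by
  rw [gaussianMeasure_eq, integral_withDensity_eq_integral_smul measurable_exp_neg_sqNorm]
  refine integral_congr_ae (Eventually.of_forall fun z => ?_)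
  simp only [NNReal.smul_def, Real.coe_toNNReal _ (Real.exp_pos _).le, Complex.real_smul]
  rw [mul_comm]

/-- The function `z ↦ ∏ⱼ fⱼ(zⱼ)`. -/
def prodFun (f : Fin n → ℂ → ℂ) (z : Cn n) : ℂ := ∏ j, f j (z j)

theorem prodFun_mul_weight (f : Fin n → ℂ → ℂ) (z : Cn n) :
    prodFun f z * (Real.exp (-sqNorm z) : ℂ) = ∏ j, (f j (z j) * (weight (z j) : ℂ)) := by
  rw [exp_neg_sqNorm, Finset.prod_mul_distrib, prodFun]
  push_cast
  rfl

theorem integral_prodFun (f : Fin n → ℂ → ℂ) :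
    ∫ z, prodFun f z ∂(gaussianMeasure n) = ∏ j, gint (f j) := by
  rw [integral_gaussianMeasure]
  simp only [prodFun_mul_weight]
  exact integral_fintype_prod_volume_eq_prod (fun j w => f j w * (weight w : ℂ))

theorem integrable_prodFun {f : Fin n → ℂ → ℂ} (hf : ∀ j, Tame (f j)) :
    Integrable (prodFun f) (gaussianMeasure n) := by
  rw [integrable_gaussianMeasure_iff]
  simp only [prodFun_mul_weight]
  exact Integrable.fintype_prod (f := fun j w => f j w * (weight w : ℂ)) fun j => (hf j).integrable

theorem continuous_prodFun {f : Fin n → ℂ → ℂ} (hf : ∀ j, Continuous (f j)) :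
    Continuous (prodFun f) := by
  unfold prodFun
  fun_prop

theorem conj_prodFun_mul (f g : Fin n → ℂ → ℂ) (z : Cn n) :
    conj (prodFun f z) * prodFun g z = prodFun (fun j w => conj (f j w) * g j w) z := by
  simp only [prodFun, map_prod, Finset.prod_mul_distrib]

theorem memLp_prodFun {f : Fin n → ℂ → ℂ} (hf : ∀ j, Tame (f j)) :
    MemLp (prodFun f) 2 (gaussianMeasure n) := by
  rw [memLp_two_iff_integrable_sq_norm
    (continuous_prodFun fun j => (hf j).1).aestronglyMeasurable]
  have h := (integrable_prodFun fun j => (hf j).conjugate.mul (hf j)).norm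
  refine h.congr (Eventually.of_forall fun z => ?_)
  simp only
  rw [← conj_prodFun_mul, norm_mul, RCLike.norm_conj, sq]

instance : IsFiniteMeasure (gaussianMeasure n) := by
  have h : Integrable (fun _ => (1 : ℂ)) (gaussianMeasure n) := by
    refine (integrable_prodFun (n := n) (f := fun _ _ => 1) fun _ => Tame.const 1).congr
      (Eventually.of_forall fun z => ?_)
    simp [prodFun]
  exact (integrable_const_iff.1 h).resolve_left one_ne_zero

theorem inner_toLp_left {f : Cn n → ℂ} (hf : MemLp f 2 (gaussianMeasure n)) (x : L2 n) :
    inner ℂ (hf.toLp f) x = ∫ z, conj (f z) * x z ∂(gaussianMeasure n) := by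
  rw [L2.inner_def]
  refine integral_congr_ae ?_
  filter_upwards [hf.coeFn_toLp] with z hz
  rw [hz, RCLike.inner_apply, mul_comm]

theorem inner_toLp_toLp {f g : Cn n → ℂ} (hf : MemLp f 2 (gaussianMeasure n))
    (hg : MemLp g 2 (gaussianMeasure n)) :
    inner ℂ (hf.toLp f) (hg.toLp g) = ∫ z, conj (f z) * g z ∂(gaussianMeasure n) := by
  rw [inner_toLp_left]
  refine integral_congr_ae ?_
  filter_upwards [hg.coeFn_toLp] with z hz
  rw [hz]

theorem norm_sq_toLp {f : Cn n → ℂ} (hf : MemLp f 2 (gaussianMeasure n)) :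
    ‖hf.toLp f‖ ^ 2 = ∫ z, ‖f z‖ ^ 2 ∂(gaussianMeasure n) := by
  have h := inner_toLp_toLp hf hf
  rw [inner_self_eq_norm_sq_to_K] at h
  have h2 : ∫ z, conj (f z) * f z ∂(gaussianMeasure n) =
      ((∫ z, ‖f z‖ ^ 2 ∂(gaussianMeasure n) : ℝ) : ℂ) := by
    rw [← integral_complex_ofReal]
    refine integral_congr_ae (Eventually.of_forall fun z => ?_)
    simp only
    rw [RCLike.conj_mul]
    push_cast
    rfl
  refine Complex.ofReal_injective ?_
  rw [← h2, ← h]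
  push_cast
  rfl

theorem integral_conj_prodFun_mul (f g : Fin n → ℂ → ℂ) :
    ∫ z, conj (prodFun f z) * prodFun g z ∂(gaussianMeasure n) =
      ∏ j, gint (fun w => conj (f j w) * g j w) := by
  simp only [conj_prodFun_mul]
  exact integral_prodFun _

/-! ### The basis of complex Hermite polynomials -/

/-- The indices of the basis: the level `q` and the degree `p` in each variable. -/
abbrev Idx (n : ℕ) : Type := (Fin n → ℕ) × (Fin n → ℕ)

/-- The product of the complex Hermite polynomials in the coordinates. -/
def hermite (a : Idx n) : Cn n → ℂ := prodFun fun j => cHermite (a.1 j) (a.2 j)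

/-- The norm of `hermite a`, squared. -/
def hermiteNormSq (a : Idx n) : ℝ :=
  ∏ j, (Real.pi * ((a.1 j).factorial * (a.2 j).factorial))

theorem hermiteNormSq_pos (a : Idx n) : 0 < hermiteNormSq a :=
  Finset.prod_pos fun j _ => mul_pos Real.pi_pos
    (by exact_mod_cast Nat.mul_pos (Nat.factorial_pos _) (Nat.factorial_pos _))

theorem integral_conj_hermite_mul (a b : Idx n) :
    ∫ z, conj (hermite a z) * hermite b z ∂(gaussianMeasure n) =
      if a = b then (hermiteNormSq a : ℂ) else 0 := by
  rw [hermite, hermite, integral_conj_prodFun_mul]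
  simp only [gint_conj_cHermite_mul_cHermite]
  split_ifs with h
  · subst h
    simp [hermiteNormSq]
  · obtain ⟨j, hj⟩ : ∃ j, ¬(a.1 j = b.1 j ∧ a.2 j = b.2 j) := by
      by_contra hc
      push Not at hc
      exact h (Prod.ext (funext fun j => (hc j).1) (funext fun j => (hc j).2))
    exact Finset.prod_eq_zero (Finset.mem_univ j) (by rw [if_neg hj, Complex.ofReal_zero])

/-- The normalized basis functions. -/
def basisFun (a : Idx n) (z : Cn n) : ℂ := ((Real.sqrt (hermiteNormSq a))⁻¹ : ℝ) * hermite a z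

theorem memLp_hermite (a : Idx n) : MemLp (hermite a) 2 (gaussianMeasure n) :=
  memLp_prodFun fun _ => tame_cHermite _ _

theorem memLp_basisFun (a : Idx n) : MemLp (basisFun a) 2 (gaussianMeasure n) :=
  (memLp_hermite a).const_mul _

theorem continuous_basisFun (a : Idx n) : Continuous (basisFun a) :=
  continuous_const.mul (continuous_prodFun fun _ => continuous_cHermite _ _)

theorem integral_conj_basisFun_mul (a b : Idx n) :
    ∫ z, conj (basisFun a z) * basisFun b z ∂(gaussianMeasure n) = if a = b then 1 else 0 := by
  have h : ∀ z, conj (basisFun a z) * basisFun b z =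
      (((Real.sqrt (hermiteNormSq a))⁻¹ : ℝ) * ((Real.sqrt (hermiteNormSq b))⁻¹ : ℝ) : ℂ) *
        (conj (hermite a z) * hermite b z) := by
    intro z
    simp only [basisFun, map_mul, Complex.conj_ofReal]
    ring
  simp only [h]
  rw [integral_const_mul, integral_conj_hermite_mul]
  split_ifs with hab
  · subst hab
    have h1 : (Real.sqrt (hermiteNormSq a))⁻¹ * (Real.sqrt (hermiteNormSq a))⁻¹ * hermiteNormSq a =
        1 := by
      rw [← mul_inv, Real.mul_self_sqrt (hermiteNormSq_pos a).le,
        inv_mul_cancel₀ (hermiteNormSq_pos a).ne']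
    exact_mod_cast h1
  · simp

/-- The basis functions as vectors of `L²`. -/
def basisVec (a : Idx n) : L2 n := (memLp_basisFun a).toLp (basisFun a)

theorem orthonormal_basisVec : Orthonormal ℂ (basisVec : Idx n → L2 n) := by
  classical
  rw [orthonormal_iff_ite]
  intro a b
  rw [basisVec, basisVec, inner_toLp_toLp, integral_conj_basisFun_mul]

/-! ### Completeness -/

/-- A real function is determined by its Fourier transform. -/
theorem ae_eq_zero_of_forall_integral_exp {E : Type*} [NormedAddCommGroup E] [NormedSpace ℝ E]
    [MeasurableSpace E] [BorelSpace E] [SecondCountableTopology E] [CompleteSpace E]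
    {μ : Measure E} {f : E → ℝ} (hf : Integrable f μ)
    (h : ∀ L : E →L[ℝ] ℝ, ∫ z, Complex.exp (L z * Complex.I) * (f z : ℂ) ∂μ = 0) :
    f =ᵐ[μ] 0 := by
  obtain ⟨g, hgm, hfg⟩ := hf.1
  have hg : Integrable g μ := hf.congr hfg
  have hfin : ∀ {u : E → ℝ}, Integrable u μ →
      IsFiniteMeasure (μ.withDensity fun z => (Real.toNNReal (u z) : ENNReal)) := fun {u} hu =>
    isFiniteMeasure_withDensity_ofReal hu.2
  have hchar : ∀ {u : E → ℝ}, Measurable u → ∀ L : E →L[ℝ] ℝ,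
      charFunDual (μ.withDensity fun z => (Real.toNNReal (u z) : ENNReal)) L =
        ∫ z, Complex.exp (L z * Complex.I) * (max (u z) 0 : ℝ) ∂μ := by
    intro u hu L
    rw [charFunDual_apply, integral_withDensity_eq_integral_smul hu.real_toNNReal]
    refine integral_congr_ae (Eventually.of_forall fun z => ?_)
    simp only [NNReal.smul_def, Real.coe_toNNReal', Complex.real_smul]
    rw [mul_comm]
  have hint : ∀ {u : E → ℝ}, Integrable u μ → ∀ L : E →L[ℝ] ℝ,
      Integrable (fun z => Complex.exp (L z * Complex.I) * (u z : ℂ)) μ := by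
    intro u hu L
    refine hu.ofReal.bdd_mul (c := 1) (Continuous.aestronglyMeasurable (by fun_prop))
      (Eventually.of_forall fun z => ?_)
    rw [Complex.norm_exp_ofReal_mul_I]
  have := hfin hg
  have := hfin hg.neg
  have hgm' := hgm.measurable
  -- The positive and negative parts of `g` are densities of finite measures with equal
  -- characteristic functions, so the measures coincide.
  have heq : (μ.withDensity fun z => (Real.toNNReal (g z) : ENNReal)) =
      μ.withDensity fun z => (Real.toNNReal ((-g) z) : ENNReal) := by
    refine Measure.ext_of_charFunDual (funext fun L => ?_)
    rw [hchar hgm', hchar hgm'.neg, ← sub_eq_zero,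
      ← integral_sub (hint hg.pos_part L) (hint hg.neg.pos_part L), ← h L]
    refine integral_congr_ae ?_
    filter_upwards [hfg] with z hz
    rw [← mul_sub, hz, ← Complex.ofReal_sub]
    congr 2
    simp only [Pi.neg_apply]
    rcases le_total (g z) 0 with h0 | h0
    · rw [max_eq_right h0, max_eq_left (by linarith)]; ring
    · rw [max_eq_left h0, max_eq_right (by linarith)]; ring
  have hgae := (withDensity_eq_iff hgm'.real_toNNReal.coe_nnreal_ennreal.aemeasurable
    hgm'.neg.real_toNNReal.coe_nnreal_ennreal.aemeasurable (by
      have := (hfin hg).measure_univ_lt_top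
      rw [withDensity_apply _ MeasurableSet.univ, setLIntegral_univ] at this
      exact this.ne)).1 heq
  filter_upwards [hfg, hgae] with z hz hz2
  rw [hz]
  have h3 : Real.toNNReal (g z) = Real.toNNReal (-g z) := by exact_mod_cast hz2
  have h4 := congrArg ((↑) : NNReal → ℝ) h3
  simp only [Real.coe_toNNReal'] at h4
  simp only [Pi.zero_apply]
  rcases le_total (g z) 0 with h0 | h0
  · rw [max_eq_right h0, max_eq_left (by linarith)] at h4; linarith
  · rw [max_eq_left h0, max_eq_right (by linarith)] at h4; linarith

/-- The coefficients are the Wirtinger derivatives of `L`. This makes powers of a real linear form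
polynomials in `z` and `z̄`. -/
theorem clm_apply_eq_sum (L : Cn n →L[ℝ] ℝ) : ∃ c d : Fin n → ℂ,
    ∀ z, (L z : ℂ) = ∑ j, (c j * z j + d j * conj (z j)) := by
  refine ⟨fun j => (L (Pi.single j 1) - L (Pi.single j Complex.I) * Complex.I) / 2,
    fun j => (L (Pi.single j 1) + L (Pi.single j Complex.I) * Complex.I) / 2, fun z => ?_⟩
  have h : ∀ j, L (Pi.single j (z j)) =
      (z j).re * L (Pi.single j 1) + (z j).im * L (Pi.single j Complex.I) := by
    intro j
    rw [← smul_eq_mul, ← smul_eq_mul, ← map_smul, ← map_smul, ← map_add, ← Pi.single_smul,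
      ← Pi.single_smul, ← Pi.single_add]
    congr 2
    simp [Complex.re_add_im]
  conv_lhs => rw [← Finset.univ_sum_single z, map_sum]
  rw [Complex.ofReal_sum]
  refine Finset.sum_congr rfl fun j _ => ?_
  rw [h]
  conv_rhs => rw [← Complex.re_add_im (z j)]
  simp only [map_add, map_mul, Complex.conj_ofReal, Complex.conj_I]
  push_cast
  linear_combination ((z j).im * (L (Pi.single j Complex.I) : ℂ)) * Complex.I_sq

theorem coord_mul_hermite (j : Fin n) (a : Idx n) (z : Cn n) :
    z j * hermite a z = hermite (a.1, Function.update a.2 j (a.2 j + 1)) z +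
      a.1 j * hermite (Function.update a.1 j (a.1 j - 1), a.2) z := by
  have hs : ∀ b : Idx n, hermite b z = cHermite (b.1 j) (b.2 j) (z j) *
      ∏ i ∈ Finset.univ.erase j, cHermite (b.1 i) (b.2 i) (z i) := fun b =>
    (Finset.mul_prod_erase _ _ (Finset.mem_univ j)).symm
  have e1 : ∏ i ∈ Finset.univ.erase j, cHermite (a.1 i) (Function.update a.2 j (a.2 j + 1) i) (z i) =
      ∏ i ∈ Finset.univ.erase j, cHermite (a.1 i) (a.2 i) (z i) :=
    Finset.prod_congr rfl fun i hi => by rw [Function.update_of_ne (Finset.ne_of_mem_erase hi)]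
  have e2 : ∏ i ∈ Finset.univ.erase j, cHermite (Function.update a.1 j (a.1 j - 1) i) (a.2 i) (z i) =
      ∏ i ∈ Finset.univ.erase j, cHermite (a.1 i) (a.2 i) (z i) :=
    Finset.prod_congr rfl fun i hi => by rw [Function.update_of_ne (Finset.ne_of_mem_erase hi)]
  rw [hs, hs (_, _), hs (_, _)]
  simp only [e1, e2, Function.update_self]
  rw [← mul_assoc, mul_cHermite]
  ring

theorem conj_coord_mul_hermite (j : Fin n) (a : Idx n) (z : Cn n) :
    conj (z j) * hermite a z = hermite (Function.update a.1 j (a.1 j + 1), a.2) z +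
      a.2 j * hermite (a.1, Function.update a.2 j (a.2 j - 1)) z := by
  have hs : ∀ b : Idx n, hermite b z = cHermite (b.1 j) (b.2 j) (z j) *
      ∏ i ∈ Finset.univ.erase j, cHermite (b.1 i) (b.2 i) (z i) := fun b =>
    (Finset.mul_prod_erase _ _ (Finset.mem_univ j)).symm
  have e1 : ∏ i ∈ Finset.univ.erase j, cHermite (a.1 i) (Function.update a.2 j (a.2 j - 1) i) (z i) =
      ∏ i ∈ Finset.univ.erase j, cHermite (a.1 i) (a.2 i) (z i) :=
    Finset.prod_congr rfl fun i hi => by rw [Function.update_of_ne (Finset.ne_of_mem_erase hi)]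
  have e2 : ∏ i ∈ Finset.univ.erase j, cHermite (Function.update a.1 j (a.1 j + 1) i) (a.2 i) (z i) =
      ∏ i ∈ Finset.univ.erase j, cHermite (a.1 i) (a.2 i) (z i) :=
    Finset.prod_congr rfl fun i hi => by rw [Function.update_of_ne (Finset.ne_of_mem_erase hi)]
  rw [hs, hs (_, _), hs (_, _)]
  simp only [e1, e2, Function.update_self]
  rw [← mul_assoc, conj_mul_cHermite]
  ring

/-- The span of the Hermite functions; these are the polynomials in `z` and `z̄`. -/
def hermiteSpan (n : ℕ) : Submodule ℂ (Cn n → ℂ) := Submodule.span ℂ (Set.range hermite)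

theorem hermite_mem (a : Idx n) : hermite a ∈ hermiteSpan n := Submodule.subset_span ⟨a, rfl⟩

theorem mul_mem_hermiteSpan {u : Cn n → ℂ} (hu : ∀ a, (fun z => u z * hermite a z) ∈ hermiteSpan n)
    {g : Cn n → ℂ} (hg : g ∈ hermiteSpan n) : (fun z => u z * g z) ∈ hermiteSpan n := by
  induction hg using Submodule.span_induction with
  | mem g hg =>
    obtain ⟨a, rfl⟩ := hg
    exact hu a
  | zero =>
    have : (fun z => u z * (0 : Cn n → ℂ) z) = 0 := by
      funext z; simp
    rw [this]
    exact (hermiteSpan n).zero_mem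
  | add f g _ _ hf hg =>
    have : (fun z => u z * (f + g) z) = (fun z => u z * f z) + fun z => u z * g z := by
      funext z; simp [mul_add]
    rw [this]
    exact (hermiteSpan n).add_mem hf hg
  | smul c f _ hf =>
    have : (fun z => u z * (c • f) z) = c • fun z => u z * f z := by
      funext z; simp [mul_left_comm]
    rw [this]
    exact (hermiteSpan n).smul_mem c hf

theorem clm_mul_mem_hermiteSpan (L : Cn n →L[ℝ] ℝ) {g : Cn n → ℂ} (hg : g ∈ hermiteSpan n) :
    (fun z => (L z : ℂ) * g z) ∈ hermiteSpan n := by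
  obtain ⟨c, d, h⟩ := clm_apply_eq_sum L
  refine mul_mem_hermiteSpan (fun a => ?_) hg
  have : (fun z => (L z : ℂ) * hermite a z) = ∑ j,
      (c j • (hermite (a.1, Function.update a.2 j (a.2 j + 1)) +
        (a.1 j : ℂ) • hermite (Function.update a.1 j (a.1 j - 1), a.2)) +
      d j • (hermite (Function.update a.1 j (a.1 j + 1), a.2) +
        (a.2 j : ℂ) • hermite (a.1, Function.update a.2 j (a.2 j - 1)))) := by
    funext z
    rw [h, Finset.sum_mul, Finset.sum_apply]
    refine Finset.sum_congr rfl fun j _ => ?_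
    simp only [Pi.add_apply, Pi.smul_apply, smul_eq_mul]
    rw [← coord_mul_hermite, ← conj_coord_mul_hermite]
    ring
  rw [this]
  refine Submodule.sum_mem _ fun j _ => Submodule.add_mem _ ?_ ?_
  all_goals
    exact Submodule.smul_mem _ _ (Submodule.add_mem _ (hermite_mem _)
      (Submodule.smul_mem _ _ (hermite_mem _)))

theorem clm_pow_mem_hermiteSpan (L : Cn n →L[ℝ] ℝ) (k : ℕ) :
    (fun z => (L z : ℂ) ^ k) ∈ hermiteSpan n := by
  induction k with
  | zero =>
    convert! hermite_mem (0 : Idx n) using 1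
    funext z
    simp [hermite, prodFun, cHermite]
  | succ k ih =>
    have := clm_mul_mem_hermiteSpan L ih
    simpa only [pow_succ'] using this

/-- Since `|L z| ≤ ‖L‖ ∑ |z_j|`, a product of one-variable exponentials dominates. The bound serves
to integrate the exponential series of `L` term by term. -/
theorem memLp_exp_clm (L : Cn n →L[ℝ] ℝ) :
    MemLp (fun z => Real.exp |L z|) 2 (gaussianMeasure n) := by
  have ht : ∀ j : Fin n, Tame fun w => (Real.exp (‖L‖ * ‖w‖) : ℂ) := fun j =>
    ⟨by fun_prop, 1, ‖L‖, zero_le_one, norm_nonneg _, fun w => by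
      rw [Complex.norm_real, Real.norm_of_nonneg (Real.exp_pos _).le, one_mul]⟩
  refine (memLp_prodFun ht).mono (Continuous.aestronglyMeasurable (by fun_prop))
    (Eventually.of_forall fun z => ?_)
  rw [prodFun, norm_prod, Real.norm_of_nonneg (Real.exp_pos _).le]
  simp only [Complex.norm_real, Real.norm_of_nonneg (Real.exp_pos _).le]
  rw [← Real.exp_sum, ← Finset.mul_sum]
  refine Real.exp_le_exp.2 ((L.le_opNorm z).trans (mul_le_mul_of_nonneg_left ?_ (norm_nonneg _)))
  refine (pi_norm_le_iff_of_nonneg (Finset.sum_nonneg fun j _ => norm_nonneg _)).2 fun j => ?_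
  exact Finset.single_le_sum (f := fun j => ‖z j‖) (fun j _ => norm_nonneg _) (Finset.mem_univ j)

theorem integral_mul_eq_zero_of_mem_hermiteSpan {x : L2 n} (h : ∀ a, inner ℂ (basisVec a) x = 0)
    {g : Cn n → ℂ} (hg : g ∈ hermiteSpan n) :
    MemLp g 2 (gaussianMeasure n) ∧ ∫ z, conj (g z) * x z ∂(gaussianMeasure n) = 0 := by
  have hi : ∀ {g : Cn n → ℂ}, MemLp g 2 (gaussianMeasure n) →
      Integrable (fun z => conj (g z) * x z) (gaussianMeasure n) := fun hg =>
    hg.star.integrable_mul (Lp.memLp x)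
  induction hg using Submodule.span_induction with
  | mem g hg =>
    obtain ⟨a, rfl⟩ := hg
    refine ⟨memLp_hermite a, ?_⟩
    have h1 := h a
    rw [basisVec, inner_toLp_left] at h1
    simp only [basisFun, map_mul, Complex.conj_ofReal, mul_assoc] at h1
    rw [integral_const_mul, mul_eq_zero] at h1
    refine h1.resolve_left ?_
    have := (Real.sqrt_pos.2 (hermiteNormSq_pos a)).ne'
    exact_mod_cast inv_ne_zero this
  | zero => exact ⟨MemLp.zero, by simp⟩
  | add f g _ _ hf hg =>
    refine ⟨hf.1.add hg.1, ?_⟩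
    simp only [Pi.add_apply, map_add, add_mul]
    rw [integral_add (hi hf.1) (hi hg.1), hf.2, hg.2, add_zero]
  | smul c f _ hf =>
    refine ⟨hf.1.const_smul c, ?_⟩
    simp only [Pi.smul_apply, smul_eq_mul, map_mul, mul_assoc]
    rw [integral_const_mul, hf.2, mul_zero]

/-- A vector orthogonal to the basis is orthogonal to all powers of `L`, hence to each term of the
exponential series. The series is dominated by `exp |L| * ‖x‖`, a product of two square integrable
functions. -/
theorem integral_exp_clm_mul_eq_zero {x : L2 n} (h : ∀ a, inner ℂ (basisVec a) x = 0)
    (L : Cn n →L[ℝ] ℝ) :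
    ∫ z, Complex.exp (L z * Complex.I) * x z ∂(gaussianMeasure n) = 0 := by
  have hs : ∀ z, HasSum (fun k : ℕ => |L z| ^ k / k.factorial * ‖x z‖) (Real.exp |L z| * ‖x z‖) := by
    intro z
    have := NormedSpace.expSeries_div_hasSum_exp |L z|
    rw [← Real.exp_eq_exp_ℝ] at this
    exact this.mul_right _
  have key := hasSum_integral_of_dominated_convergence (μ := gaussianMeasure n)
    (F := fun (k : ℕ) z => (L z * Complex.I) ^ k / k.factorial * x z)
    (f := fun z => Complex.exp (L z * Complex.I) * x z)
    (fun k z => |L z| ^ k / k.factorial * ‖x z‖)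
    (fun k => AEStronglyMeasurable.mul (Continuous.aestronglyMeasurable (by fun_prop))
      (Lp.memLp x).1)
    (fun k => Eventually.of_forall fun z => by simp)
    (Eventually.of_forall fun z => (hs z).summable)
    (by
      simp only [(hs _).tsum_eq]
      exact (memLp_exp_clm L).integrable_mul (Lp.memLp x).norm)
    (Eventually.of_forall fun z => by
      have := NormedSpace.expSeries_div_hasSum_exp (L z * Complex.I : ℂ)
      rw [← Complex.exp_eq_exp_ℂ] at this
      exact this.mul_right _)
  have h0 : ∀ k : ℕ, ∫ z, (L z * Complex.I) ^ k / k.factorial * x z ∂(gaussianMeasure n) = 0 := by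
    intro k
    have h1 := (integral_mul_eq_zero_of_mem_hermiteSpan h (clm_pow_mem_hermiteSpan L k)).2
    have h2 : ∀ z, (L z * Complex.I) ^ k / k.factorial * x z =
        (Complex.I ^ k / k.factorial) * (conj ((L z : ℂ) ^ k) * x z) := by
      intro z
      rw [map_pow, Complex.conj_ofReal]
      ring
    simp only [h2]
    rw [integral_const_mul, h1, mul_zero]
  simp only [h0] at key
  exact key.unique hasSum_zero

theorem eq_zero_of_forall_inner_basisVec {x : L2 n} (h : ∀ a, inner ℂ (basisVec a) x = 0) :
    x = 0 := by
  have hx : Integrable x (gaussianMeasure n) := (Lp.memLp x).integrable (by norm_num)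
  have hb : ∀ {u : Cn n → ℂ}, Integrable u (gaussianMeasure n) → ∀ L : Cn n →L[ℝ] ℝ,
      Integrable (fun z => Complex.exp (L z * Complex.I) * u z) (gaussianMeasure n) := by
    intro u hu L
    refine hu.bdd_mul (c := 1) (Continuous.aestronglyMeasurable (by fun_prop))
      (Eventually.of_forall fun z => ?_)
    rw [Complex.norm_exp_ofReal_mul_I]
  -- Conjugating the identity for `-L` gives the one for `conj x`, so the real and imaginary parts
  -- of `x` also have vanishing Fourier transform.
  have hc : ∀ L : Cn n →L[ℝ] ℝ,
      ∫ z, Complex.exp (L z * Complex.I) * conj (x z) ∂(gaussianMeasure n) = 0 := by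
    intro L
    have h1 := congrArg conj (integral_exp_clm_mul_eq_zero h (-L))
    rw [← integral_conj, map_zero] at h1
    rw [← h1]
    refine integral_congr_ae (Eventually.of_forall fun z => ?_)
    simp [← Complex.exp_conj]
  have hxc : Integrable (fun z => conj (x z)) (gaussianMeasure n) :=
    Complex.conjCLE.toContinuousLinearMap.integrable_comp hx
  have hre := ae_eq_zero_of_forall_integral_exp (f := fun z => (x z).re) hx.re fun L => by
    have h1 : ∀ z, Complex.exp (L z * Complex.I) * ((x z).re : ℂ) =
        1 / 2 * (Complex.exp (L z * Complex.I) * x z + Complex.exp (L z * Complex.I) * conj (x z)) := by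
      intro z
      rw [Complex.re_eq_add_conj]; ring
    simp only [h1]
    rw [integral_const_mul, integral_add (hb hx L) (hb hxc L), integral_exp_clm_mul_eq_zero h, hc]
    simp
  have him := ae_eq_zero_of_forall_integral_exp (f := fun z => (x z).im) hx.im fun L => by
    have h1 : ∀ z, Complex.exp (L z * Complex.I) * ((x z).im : ℂ) =
        1 / (2 * Complex.I) *
          (Complex.exp (L z * Complex.I) * x z - Complex.exp (L z * Complex.I) * conj (x z)) := by
      intro z
      rw [Complex.im_eq_sub_conj]; ring
    simp only [h1]
    rw [integral_const_mul, integral_sub (hb hx L) (hb hxc L), integral_exp_clm_mul_eq_zero h, hc]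
    simp
  refine (Lp.eq_zero_iff_ae_eq_zero).2 ?_
  filter_upwards [hre, him] with z h1 h2
  exact Complex.ext h1 h2

/-- The Hilbert basis of `L²(ℂⁿ, e^{-|z|²} dμ)` of normalized complex Hermite polynomials. -/
def landauBasis (n : ℕ) : HilbertBasis (Idx n) ℂ (L2 n) :=
  HilbertBasis.mkOfOrthogonalEqBot orthonormal_basisVec (by
    rw [Submodule.eq_bot_iff]
    intro x hx
    refine eq_zero_of_forall_inner_basisVec fun a => ?_
    exact (Submodule.mem_orthogonal _ _).1 hx _ (Submodule.subset_span ⟨a, rfl⟩))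

theorem landauBasis_apply (a : Idx n) : landauBasis n a = basisVec a := by
  rw [landauBasis, HilbertBasis.coe_mkOfOrthogonalEqBot]

/-! ### Symmetry on test functions -/

theorem dZ_eq_of_hasFDerivAt {f : Cn n → ℂ} {f' : Cn n →L[ℝ] ℂ} {z : Cn n}
    (h : HasFDerivAt f f' z) (j : Fin n) :
    dZ j f z = 1 / 2 * (f' (Pi.single j 1) - Complex.I * f' (Pi.single j Complex.I)) := by
  rw [dZ, dX, dY, h.fderiv]

theorem dZbar_eq_of_hasFDerivAt {f : Cn n → ℂ} {f' : Cn n →L[ℝ] ℂ} {z : Cn n}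
    (h : HasFDerivAt f f' z) (j : Fin n) :
    dZbar j f z = 1 / 2 * (f' (Pi.single j 1) + Complex.I * f' (Pi.single j Complex.I)) := by
  rw [dZbar, dX, dY, h.fderiv]

theorem dZ_mul (j : Fin n) {f g : Cn n → ℂ} {z : Cn n} (hf : DifferentiableAt ℝ f z)
    (hg : DifferentiableAt ℝ g z) :
    dZ j (fun z => f z * g z) z = dZ j f z * g z + f z * dZ j g z := by
  have h : HasFDerivAt (fun z => f z * g z) (f z • fderiv ℝ g z + g z • fderiv ℝ f z) z :=
    hf.hasFDerivAt.mul hg.hasFDerivAt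
  rw [dZ_eq_of_hasFDerivAt h, dZ_eq_of_hasFDerivAt hf.hasFDerivAt,
    dZ_eq_of_hasFDerivAt hg.hasFDerivAt]
  simp only [add_apply, smul_apply, smul_eq_mul]
  ring

theorem dZ_conj (j : Fin n) {f : Cn n → ℂ} {z : Cn n} (hf : DifferentiableAt ℝ f z) :
    dZ j (fun z => conj (f z)) z = conj (dZbar j f z) := by
  have h : HasFDerivAt (fun z => conj (f z))
      ((Complex.conjCLE : ℂ ≃L[ℝ] ℂ).toContinuousLinearMap.comp (fderiv ℝ f z)) z :=
    (Complex.conjCLE : ℂ ≃L[ℝ] ℂ).hasFDerivAt.comp z hf.hasFDerivAt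
  rw [dZ_eq_of_hasFDerivAt h, dZbar_eq_of_hasFDerivAt hf.hasFDerivAt]
  simp [sub_eq_add_neg]
  exact Or.inl (map_ofNat (starRingEnd ℂ) 2).symm

/-- The derivative of `∏ⱼ fⱼ(zⱼ)` in the direction of a coordinate. -/
theorem hasFDerivAt_prodFun {f : Fin n → ℂ → ℂ} {f₁ f₂ : Fin n → ℂ} {z : Cn n}
    (h : ∀ j, HasWirtinger (f j) (f₁ j) (f₂ j) (z j)) :
    ∃ F' : Cn n →L[ℝ] ℂ, HasFDerivAt (prodFun f) F' z ∧ ∀ j v, F' (Pi.single j v) =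
      (∏ i ∈ Finset.univ.erase j, f i (z i)) * (f₁ j * v + f₂ j * conj v) := by
  classical
  have h1 : ∀ i ∈ (Finset.univ : Finset (Fin n)), HasFDerivAt (fun z : Cn n => f i (z i))
      ((f₁ i • ContinuousLinearMap.id ℝ ℂ +
        f₂ i • (Complex.conjCLE : ℂ ≃L[ℝ] ℂ).toContinuousLinearMap).comp
        (ContinuousLinearMap.proj i)) z := fun i _ =>
    HasFDerivAt.comp (g := f i) z (h i) (hasFDerivAt_apply i z)
  refine ⟨_, HasFDerivAt.finsetProd h1, fun j v => ?_⟩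
  rw [sum_apply, Finset.sum_eq_single j]
  · simp [mul_add]
  · intro i _ hij
    simp [Pi.single_eq_of_ne hij]
  · simp

theorem dZ_prodFun {f : Fin n → ℂ → ℂ} {f₁ f₂ : Fin n → ℂ} {z : Cn n}
    (h : ∀ j, HasWirtinger (f j) (f₁ j) (f₂ j) (z j)) (j : Fin n) :
    dZ j (prodFun f) z = (∏ i ∈ Finset.univ.erase j, f i (z i)) * f₁ j := by
  obtain ⟨F', hF, hF'⟩ := hasFDerivAt_prodFun h
  rw [dZ_eq_of_hasFDerivAt hF, hF', hF', map_one, Complex.conj_I]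
  linear_combination (-(∏ i ∈ Finset.univ.erase j, f i (z i)) / 2 * (f₁ j - f₂ j)) * Complex.I_sq

theorem dZbar_prodFun {f : Fin n → ℂ → ℂ} {f₁ f₂ : Fin n → ℂ} {z : Cn n}
    (h : ∀ j, HasWirtinger (f j) (f₁ j) (f₂ j) (z j)) (j : Fin n) :
    dZbar j (prodFun f) z = (∏ i ∈ Finset.univ.erase j, f i (z i)) * f₂ j := by
  obtain ⟨F', hF, hF'⟩ := hasFDerivAt_prodFun h
  rw [dZbar_eq_of_hasFDerivAt hF, hF', hF', map_one, Complex.conj_I]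
  linear_combination ((∏ i ∈ Finset.univ.erase j, f i (z i)) / 2 * (f₁ j - f₂ j)) * Complex.I_sq

theorem contDiff_exp_neg_sqNorm : ContDiff ℝ ∞ fun z : Cn n => (Real.exp (-sqNorm z) : ℂ) := by
  have h : ContDiff ℝ ∞ (sqNorm : Cn n → ℝ) := by
    unfold sqNorm
    exact ContDiff.sum fun j _ => (contDiff_apply ℝ ℂ j).norm_sq ℝ
  exact Complex.ofRealCLM.contDiff.comp h.neg.exp

theorem exp_neg_sqNorm_eq_prodFun :
    (fun z : Cn n => (Real.exp (-sqNorm z) : ℂ)) = prodFun fun _ w => (weight w : ℂ) := by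
  funext z
  rw [exp_neg_sqNorm, prodFun, Complex.ofReal_prod]

theorem dZ_exp_neg_sqNorm (j : Fin n) (z : Cn n) :
    dZ j (fun z : Cn n => (Real.exp (-sqNorm z) : ℂ)) z =
      -conj (z j) * (Real.exp (-sqNorm z) : ℂ) := by
  rw [exp_neg_sqNorm_eq_prodFun, dZ_prodFun (fun j => hasWirtinger_weight (z j)),
    congrFun exp_neg_sqNorm_eq_prodFun z, prodFun, ← Finset.mul_prod_erase _ _ (Finset.mem_univ j)]
  ring

theorem integrable_volume_of_mem {f : Cn n → ℂ} (hf : f ∈ testFun n) : Integrable f :=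
  hf.1.continuous.integrable_of_hasCompactSupport hf.2

theorem integrable_of_mem {f : Cn n → ℂ} (hf : f ∈ testFun n) : Integrable f (gaussianMeasure n) :=
  hf.1.continuous.integrable_of_hasCompactSupport hf.2

theorem memLp_of_mem {f : Cn n → ℂ} (hf : f ∈ testFun n) : MemLp f 2 (gaussianMeasure n) :=
  hf.1.continuous.memLp_of_hasCompactSupport hf.2

theorem integral_dZ_eq_zero (j : Fin n) {F : Cn n → ℂ} (hF : F ∈ testFun n) :
    ∫ z, dZ j F z = 0 := by
  have hd := fun v => integral_fderiv_eq_zero (μ := (volume : Measure (Cn n))) (F := F)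
    (F' := fun z => fderiv ℝ F z) (fun z => (differentiable_of_mem hF z).hasFDerivAt) v
    (integrable_volume_of_mem hF) (integrable_volume_of_mem (fderiv_apply_mem hF v))
  have hX : ∫ z, dX j F z = 0 := hd _
  have hY : ∫ z, dY j F z = 0 := hd _
  have iX : Integrable (dX j F) := integrable_volume_of_mem (fderiv_apply_mem hF _)
  have iY : Integrable (dY j F) := integrable_volume_of_mem (fderiv_apply_mem hF _)
  simp only [dZ]
  rw [integral_const_mul, integral_sub iX (iY.const_mul _), integral_const_mul, hX, hY]
  simp

/-- Integration by parts against the Gaussian measure for test functions. -/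
theorem integral_conj_mul_sub_dZ (j : Fin n) {f : Cn n → ℂ} (hf : f ∈ testFun n) :
    ∫ z, (conj (z j) * f z - dZ j f z) ∂(gaussianMeasure n) = 0 := by
  have hF : (fun z => f z * (Real.exp (-sqNorm z) : ℂ)) ∈ testFun n :=
    ⟨hf.1.mul contDiff_exp_neg_sqNorm, hf.2.mul_right⟩
  rw [integral_gaussianMeasure, ← neg_eq_zero, ← integral_neg, ← integral_dZ_eq_zero j hF]
  refine integral_congr_ae (Eventually.of_forall fun z => ?_)
  simp only
  rw [dZ_mul j (differentiable_of_mem hf z) (contDiff_exp_neg_sqNorm.differentiable (by simp) z),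
    dZ_exp_neg_sqNorm]
  ring

theorem conj_mem {f : Cn n → ℂ} (hf : f ∈ testFun n) : (fun z => conj (f z)) ∈ testFun n :=
  ⟨Complex.conjCLE.contDiff.comp hf.1, hf.2.comp_left (map_zero _)⟩

theorem mul_mem_testFun {f g : Cn n → ℂ} (hf : f ∈ testFun n) (hg : g ∈ testFun n) :
    (fun z => f z * g z) ∈ testFun n :=
  ⟨hf.1.mul hg.1, hf.2.mul_right⟩

/-- The Dirichlet form of the differential expression. -/
theorem integral_conj_mul_diffExpr {f g : Cn n → ℂ} (hf : f ∈ testFun n) (hg : g ∈ testFun n) :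
    ∫ z, conj (g z) * diffExpr f z ∂(gaussianMeasure n) =
      ∑ j, ∫ z, conj (dZbar j g z) * dZbar j f z ∂(gaussianMeasure n) := by
  have h1 : ∀ j, (fun z => conj (g z) * dZbar j f z) ∈ testFun n := fun j =>
    mul_mem_testFun (conj_mem hg) (dZbar_mem j hf)
  -- The Leibniz rule for `conj g * ∂f/∂z̄_j` isolates terms of the form `z̄_j F - ∂F/∂z_j`, which
  -- integrate to zero.
  have h2 : ∀ z, conj (g z) * diffExpr f z =
      ∑ j, ((conj (z j) * (conj (g z) * dZbar j f z) -
        dZ j (fun z => conj (g z) * dZbar j f z) z) + conj (dZbar j g z) * dZbar j f z) := by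
    intro z
    rw [diffExpr, ← Finset.sum_neg_distrib, ← Finset.sum_add_distrib, Finset.mul_sum]
    refine Finset.sum_congr rfl fun j _ => ?_
    rw [dZ_mul j (differentiable_of_mem (conj_mem hg) z) (differentiable_of_mem (dZbar_mem j hf) z),
      dZ_conj j (differentiable_of_mem hg z)]
    ring
  have i1 : ∀ j, Integrable (fun z => conj (z j) * (conj (g z) * dZbar j f z) -
      dZ j (fun z => conj (g z) * dZbar j f z) z) (gaussianMeasure n) := fun j =>
    (integrable_of_mem (conj_mul_mem j (h1 j))).sub (integrable_of_mem (dZ_mem j (h1 j)))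
  have i2 : ∀ j, Integrable (fun z => conj (dZbar j g z) * dZbar j f z) (gaussianMeasure n) :=
    fun j => integrable_of_mem (mul_mem_testFun (conj_mem (dZbar_mem j hg)) (dZbar_mem j hf))
  simp only [h2]
  have i3 : ∀ j ∈ Finset.univ, Integrable (fun z => conj (z j) * (conj (g z) * dZbar j f z) -
      dZ j (fun z => conj (g z) * dZbar j f z) z + conj (dZbar j g z) * dZbar j f z)
      (gaussianMeasure n) := fun j _ => (i1 j).add (i2 j)
  rw [integral_finsetSum _ i3]
  refine Finset.sum_congr rfl fun j _ => ?_
  rw [integral_add (i1 j) (i2 j), integral_conj_mul_sub_dZ j (h1 j), zero_add]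

/-- Both sides equal the Dirichlet form, which is Hermitian. -/
theorem inner_testOp_eq (f g : testFun n) :
    inner ℂ (testToL2 n g) (testToL2 n (testOp n f)) =
      inner ℂ (testToL2 n (testOp n g)) (testToL2 n f) := by
  have h : ∀ f g : testFun n, inner ℂ (testToL2 n g) (testToL2 n (testOp n f)) =
      ∑ j, ∫ z, conj (dZbar j g.1 z) * dZbar j f.1 z ∂(gaussianMeasure n) := fun f g => by
    rw [← integral_conj_mul_diffExpr f.2 g.2]
    exact inner_toLp_toLp (memLp_of_mem g.2) (memLp_of_mem (testOp n f).2)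
  rw [h, ← inner_conj_symm, h, map_sum]
  refine Finset.sum_congr rfl fun j _ => ?_
  rw [← integral_conj]
  refine integral_congr_ae (Eventually.of_forall fun z => ?_)
  simp [mul_comm]

/-! ### Cutoffs of the complex Hermite polynomials -/

/-- The Wirtinger derivative `∂f/∂z`. -/
def wz (f : ℂ → ℂ) (w : ℂ) : ℂ := 1 / 2 * (fderiv ℝ f w 1 - Complex.I * fderiv ℝ f w Complex.I)

/-- The Wirtinger derivative `∂f/∂z̄`. -/
def wzbar (f : ℂ → ℂ) (w : ℂ) : ℂ := 1 / 2 * (fderiv ℝ f w 1 + Complex.I * fderiv ℝ f w Complex.I)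

theorem hasWirtinger_of_differentiableAt {f : ℂ → ℂ} {w : ℂ} (h : DifferentiableAt ℝ f w) :
    HasWirtinger f (wz f w) (wzbar f w) w := by
  refine h.hasFDerivAt.congr_fderiv ?_
  ext v
  have hv : v = v.re • (1 : ℂ) + v.im • Complex.I := by simp [Complex.re_add_im]
  simp only [add_apply, smul_apply, ContinuousLinearMap.id_apply, smul_eq_mul,
    ContinuousLinearEquiv.coe_coe, Complex.conjCLE_apply, wz, wzbar]
  have hc : conj v = v.re - v.im * Complex.I := by
    apply Complex.ext <;> simp
  have hv' : v = v.re + v.im * Complex.I := (Complex.re_add_im v).symm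
  rw [hc]
  conv_lhs => rw [hv]
  conv_rhs => rw [hv']
  rw [map_add, map_smul, map_smul, Complex.real_smul, Complex.real_smul]
  simp only [Complex.add_re, Complex.ofReal_re, Complex.mul_re, Complex.I_re, mul_zero,
    Complex.ofReal_im, Complex.I_im, mul_one, sub_self, add_zero, Complex.add_im, Complex.mul_im,
    zero_add]
  linear_combination (v.im * fderiv ℝ f w Complex.I : ℂ) * Complex.I_sq

theorem HasWirtinger.wz_eq {f : ℂ → ℂ} {f₁ f₂ w : ℂ} (h : HasWirtinger f f₁ f₂ w) :
    wz f w = f₁ := by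
  rw [wz, h.fderiv_apply, h.fderiv_apply, map_one, Complex.conj_I]
  linear_combination (-(f₁ - f₂) / 2) * Complex.I_sq

theorem HasWirtinger.wzbar_eq {f : ℂ → ℂ} {f₁ f₂ w : ℂ} (h : HasWirtinger f f₁ f₂ w) :
    wzbar f w = f₂ := by
  rw [wzbar, h.fderiv_apply, h.fderiv_apply, map_one, Complex.conj_I]
  linear_combination ((f₁ - f₂) / 2) * Complex.I_sq

theorem contDiff_wz {f : ℂ → ℂ} (hf : ContDiff ℝ ∞ f) : ContDiff ℝ ∞ (wz f) := by
  have h : ∀ v, ContDiff ℝ ∞ fun w => fderiv ℝ f w v := fun v =>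
    (hf.fderiv_right (m := ∞) (by simp)).clm_apply contDiff_const
  exact contDiff_const.mul ((h _).sub (contDiff_const.mul (h _)))

theorem contDiff_wzbar {f : ℂ → ℂ} (hf : ContDiff ℝ ∞ f) : ContDiff ℝ ∞ (wzbar f) := by
  have h : ∀ v, ContDiff ℝ ∞ fun w => fderiv ℝ f w v := fun v =>
    (hf.fderiv_right (m := ∞) (by simp)).clm_apply contDiff_const
  exact contDiff_const.mul ((h _).add (contDiff_const.mul (h _)))

theorem hasCompactSupport_wz {f : ℂ → ℂ} (hf : HasCompactSupport f) : HasCompactSupport (wz f) := by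
  have h : ∀ v, HasCompactSupport fun w => fderiv ℝ f w v := fun v => hf.fderiv_apply (𝕜 := ℝ) v
  exact HasCompactSupport.mul_left ((h _).sub (HasCompactSupport.mul_left (h _)))

theorem hasCompactSupport_wzbar {f : ℂ → ℂ} (hf : HasCompactSupport f) :
    HasCompactSupport (wzbar f) := by
  have h : ∀ v, HasCompactSupport fun w => fderiv ℝ f w v := fun v => hf.fderiv_apply (𝕜 := ℝ) v
  exact HasCompactSupport.mul_left ((h _).add (HasCompactSupport.mul_left (h _)))

theorem wz_congr {f g : ℂ → ℂ} {w : ℂ} (h : f =ᶠ[𝓝 w] g) : wz f w = wz g w := by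
  rw [wz, wz, h.fderiv_eq]

theorem wzbar_congr {f g : ℂ → ℂ} {w : ℂ} (h : f =ᶠ[𝓝 w] g) : wzbar f =ᶠ[𝓝 w] wzbar g := by
  filter_upwards [h.eventuallyEq_nhds] with v hv
  rw [wzbar, wzbar, hv.fderiv_eq]

/-- The one variable differential expression `-∂²f/∂z∂z̄ + z̄ ∂f/∂z̄`. -/
def diffExpr₁ (f : ℂ → ℂ) (w : ℂ) : ℂ := -wz (wzbar f) w + conj w * wzbar f w

theorem diffExpr₁_congr {f g : ℂ → ℂ} {w : ℂ} (h : f =ᶠ[𝓝 w] g) : diffExpr₁ f w = diffExpr₁ g w := by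
  rw [diffExpr₁, diffExpr₁, wz_congr (wzbar_congr h), (wzbar_congr h).eq_of_nhds]

theorem wzbar_cHermite (q p : ℕ) : wzbar (cHermite q p) = fun w => q * cHermite (q - 1) p w :=
  funext fun w => (hasWirtinger_cHermite q p w).wzbar_eq

/-- `∂/∂z̄` lowers the level with the factor `q`, and `-∂/∂z + z̄` raises it back: the expression is
the number operator. -/
theorem diffExpr₁_cHermite (q p : ℕ) (w : ℂ) : diffExpr₁ (cHermite q p) w = q * cHermite q p w := by
  have h : HasWirtinger (fun w => q * cHermite (q - 1) p w)
      (0 * cHermite (q - 1) p w + q * (p * cHermite (q - 1) (p - 1) w)) _ w :=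
    (hasWirtinger_const (q : ℂ) w).mul (hasWirtinger_cHermite (q - 1) p w)
  rw [diffExpr₁, wzbar_cHermite, h.wz_eq]
  cases q with
  | zero => simp
  | succ q => rw [cHermite_succ, Nat.add_sub_cancel]; ring

theorem contDiff_cHermite (q p : ℕ) : ContDiff ℝ ∞ (cHermite q p) := by
  induction q generalizing p with
  | zero => exact contDiff_id.pow p
  | succ q ih =>
    exact (Complex.conjCLE.contDiff.mul (ih p)).sub (contDiff_const.mul (ih (p - 1)))

/-- A smooth cutoff function on `ℂ`. -/
def cutoff (w : ℂ) : ℂ := ((⟨1, 2, one_pos, one_lt_two⟩ : ContDiffBump (0 : ℂ)) w : ℝ)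

theorem contDiff_cutoff : ContDiff ℝ ∞ cutoff :=
  Complex.ofRealCLM.contDiff.comp (ContDiffBump.contDiff _)

theorem hasCompactSupport_cutoff : HasCompactSupport cutoff :=
  (ContDiffBump.hasCompactSupport _).comp_left Complex.ofReal_zero

theorem cutoff_eq_one {w : ℂ} (h : ‖w‖ ≤ 1) : cutoff w = 1 := by
  rw [cutoff, ContDiffBump.one_of_mem_closedBall, Complex.ofReal_one]
  simpa using h

/-- The cutoff of `f` at scale `k + 1`. -/
def cutAt (k : ℕ) (f : ℂ → ℂ) (w : ℂ) : ℂ := cutoff (((k : ℂ) + 1)⁻¹ * w) * f w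

theorem contDiff_cutAt (k : ℕ) {f : ℂ → ℂ} (hf : ContDiff ℝ ∞ f) : ContDiff ℝ ∞ (cutAt k f) :=
  (contDiff_cutoff.comp (contDiff_const.mul contDiff_id)).mul hf

theorem natCast_add_one_ne_zero (k : ℕ) : ((k : ℂ) + 1) ≠ 0 := by exact_mod_cast k.succ_ne_zero

theorem hasCompactSupport_cutAt (k : ℕ) (f : ℂ → ℂ) : HasCompactSupport (cutAt k f) := by
  refine HasCompactSupport.mul_right ?_
  exact hasCompactSupport_cutoff.comp_homeomorph
    (Homeomorph.mulLeft₀ ((k : ℂ) + 1)⁻¹ (inv_ne_zero (natCast_add_one_ne_zero k)))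

/-- Agreement of germs, not just of values, is needed: it carries over to the derivatives in
`diffExpr₁`. -/
theorem cutAt_eventuallyEq (f : ℂ → ℂ) (w : ℂ) : ∀ᶠ k : ℕ in atTop, cutAt k f =ᶠ[𝓝 w] f := by
  obtain ⟨N, hN⟩ := exists_nat_gt ‖w‖
  filter_upwards [eventually_ge_atTop N] with k hk
  have h : ∀ᶠ v in 𝓝 w, ‖v‖ < (k : ℝ) + 1 := by
    refine continuous_norm.continuousAt.eventually_lt continuousAt_const ?_
    have : (N : ℝ) ≤ k := by exact_mod_cast hk
    linarith
  filter_upwards [h] with v hv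
  rw [cutAt, cutoff_eq_one, one_mul]
  rw [norm_mul, norm_inv, ← Nat.cast_succ, Complex.norm_natCast, Nat.cast_succ, inv_mul_le_iff₀ (by positivity), mul_one]
  exact hv.le

theorem norm_scale_le_one (k : ℕ) : ‖((k : ℂ) + 1)⁻¹‖ ≤ 1 := by
  rw [norm_inv, ← Nat.cast_succ, Complex.norm_natCast]
  refine inv_le_one_of_one_le₀ ?_
  rw [Nat.cast_succ]
  linarith [(Nat.cast_nonneg k : (0 : ℝ) ≤ k)]

theorem hasWirtinger_scale {f : ℂ → ℂ} (hf : Differentiable ℝ f) (c w : ℂ) (hc : conj c = c) :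
    HasWirtinger (fun w => f (c * w)) (c * wz f (c * w)) (c * wzbar f (c * w)) w := by
  have hl : HasWirtinger (fun w => c * w) c 0 w :=
    ((hasWirtinger_const c w).mul (hasWirtinger_id w)).of_eq (by simp) (by simp)
  refine HasFDerivAt.congr_fderiv (HasFDerivAt.comp (g := f) (f := fun w => c * w) w
    (hasWirtinger_of_differentiableAt (hf (c * w))) hl) ?_
  ext v
  simp [hc]
  ring

theorem norm_mul_le_of_le_one {a b c : ℂ} {M : ℝ} (ha : ‖a‖ ≤ 1) (hb : ‖b‖ ≤ M) :
    ‖a * b * c‖ ≤ M * ‖c‖ := by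
  rw [norm_mul, norm_mul]
  have h0 := norm_nonneg b
  have : ‖a‖ * ‖b‖ ≤ M := by nlinarith [norm_nonneg a]
  exact mul_le_mul_of_nonneg_right this (norm_nonneg c)

/-- The cutoffs of a complex Hermite polynomial, and the differential expression applied to them,
are of uniform exponential growth. -/
theorem cutAt_cHermite_bound (q p : ℕ) : ∃ B : ℂ → ℂ, Tame B ∧ ∀ k w,
    ‖cutAt k (cHermite q p) w‖ ≤ ‖B w‖ ∧ ‖diffExpr₁ (cutAt k (cHermite q p)) w‖ ≤ ‖B w‖ := by
  have hχ := contDiff_cutoff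
  have sχ := hasCompactSupport_cutoff
  have h2 := contDiff_wzbar hχ
  have s2 := hasCompactSupport_wzbar sχ
  obtain ⟨M₀, hM₀⟩ := hχ.continuous.bounded_above_of_compact_support sχ
  obtain ⟨M₁, hM₁⟩ := (contDiff_wz hχ).continuous.bounded_above_of_compact_support
    (hasCompactSupport_wz sχ)
  obtain ⟨M₂, hM₂⟩ := h2.continuous.bounded_above_of_compact_support s2
  obtain ⟨M₃, hM₃⟩ := (contDiff_wz h2).continuous.bounded_above_of_compact_support
    (hasCompactSupport_wz s2)
  have e0 : 0 ≤ M₀ := (norm_nonneg _).trans (hM₀ 0)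
  have e1 : 0 ≤ M₁ := (norm_nonneg _).trans (hM₁ 0)
  have e2 : 0 ≤ M₂ := (norm_nonneg _).trans (hM₂ 0)
  have e3 : 0 ≤ M₃ := (norm_nonneg _).trans (hM₃ 0)
  set M := max (max M₀ M₁) (max M₂ M₃)
  have m0 : M₀ ≤ M := (le_max_left _ _).trans (le_max_left _ _)
  have m1 : M₁ ≤ M := (le_max_right _ _).trans (le_max_left _ _)
  have m2 : M₂ ≤ M := (le_max_left _ _).trans (le_max_right _ _)
  have m3 : M₃ ≤ M := (le_max_right _ _).trans (le_max_right _ _)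
  have hM : 0 ≤ M := e0.trans m0
  set h := cHermite q p with hh
  set ha : ℂ → ℂ := fun w => p * cHermite q (p - 1) w with hha
  set hb : ℂ → ℂ := fun w => q * cHermite (q - 1) p w with hhb
  set hab : ℂ → ℂ := fun w => q * (p * cHermite (q - 1) (p - 1) w) with hhab
  have tn : ∀ f : ℂ → ℂ, Tame f → Tame (fun w => (‖f w‖ : ℂ)) := fun f ⟨hc, C, c, hC, hc', h⟩ =>
    ⟨by fun_prop, C, c, hC, hc', fun w => by simpa using h w⟩
  have th := tn h (tame_cHermite q p)
  have tha := tn ha ((Tame.const _).mul (tame_cHermite _ _))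
  have thb := tn hb ((Tame.const _).mul (tame_cHermite _ _))
  have thab := tn hab ((Tame.const _).mul ((Tame.const _).mul (tame_cHermite _ _)))
  -- By the Leibniz rule each derivative falls on the cutoff, at the cost of a scale at most 1 and
  -- the bound `M`, or on the Hermite polynomial. The terms with `‖w‖` bound `z̄ ∂/∂z̄`.
  refine ⟨fun w => M * ((((‖h w‖ + ‖ha w‖) + (‖hb w‖ + ‖hab w‖)) +
    ‖w‖ * (‖h w‖ + ‖hb w‖) : ℂ)), (Tame.const _).mul (((th.add tha).add (thb.add thab)).add
      ((tn _ Tame.id).mul (th.add thb))), fun k w => ?_⟩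
  have hB : ‖(M * ((((‖h w‖ + ‖ha w‖) + (‖hb w‖ + ‖hab w‖)) +
      ‖w‖ * (‖h w‖ + ‖hb w‖) : ℂ)) : ℂ)‖ =
      M * (((‖h w‖ + ‖ha w‖) + (‖hb w‖ + ‖hab w‖)) + ‖w‖ * (‖h w‖ + ‖hb w‖)) := by
    rw [← Real.norm_of_nonneg (r := M * _) (by positivity), ← Complex.norm_real]
    push_cast
    rfl
  rw [hB]
  set c : ℂ := ((k : ℂ) + 1)⁻¹ with hc
  have hcc : conj c = c := by simp [hc]
  have hc1 : ‖c‖ ≤ 1 := norm_scale_le_one k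
  have hcut : cutAt k h = fun w => cutoff (c * w) * h w := rfl
  have hw : ∀ w, HasWirtinger (cutAt k h) (c * wz cutoff (c * w) * h w + cutoff (c * w) * ha w)
      (c * wzbar cutoff (c * w) * h w + cutoff (c * w) * hb w) w := fun w =>
    (hasWirtinger_scale (hχ.differentiable (by simp)) c w hcc).mul (hasWirtinger_cHermite q p w)
  have hwb : wzbar (cutAt k h) =
      fun w => c * wzbar cutoff (c * w) * h w + cutoff (c * w) * hb w :=
    funext fun w => (hw w).wzbar_eq
  have hbw : HasWirtinger hb (hab w) (q * ((q - 1 : ℕ) * cHermite (q - 1 - 1) p w)) w :=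
    ((hasWirtinger_const (q : ℂ) w).mul (hasWirtinger_cHermite (q - 1) p w)).of_eq
      (by simp [hhab]) (by simp)
  have hw2 := ((((hasWirtinger_const c w).mul (hasWirtinger_scale (h2.differentiable (by simp)) c w hcc)).mul
    (hasWirtinger_cHermite q p w)).add
    ((hasWirtinger_scale (hχ.differentiable (by simp)) c w hcc).mul hbw)).wz_eq
  have n0 := hM₀ (c * w)
  have n1 := hM₁ (c * w)
  have n2 := hM₂ (c * w)
  have n3 := hM₃ (c * w)
  have one1 : ‖(1 : ℂ)‖ ≤ 1 := by simp
  have hcc1 : ‖c * c‖ ≤ 1 := by rw [norm_mul]; nlinarith [norm_nonneg c]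
  constructor
  · have := norm_mul_le_of_le_one (c := h w) one1 (n0.trans m0)
    rw [one_mul] at this
    refine this.trans (mul_le_mul_of_nonneg_left ?_ hM)
    have := norm_nonneg (ha w)
    have := norm_nonneg (hb w)
    have := norm_nonneg (hab w)
    have : 0 ≤ ‖w‖ * (‖h w‖ + ‖hb w‖) := by positivity
    linarith
  · have hD : diffExpr₁ (cutAt k h) w =
        -(((c * c) * wz (wzbar cutoff) (c * w) * h w + c * wzbar cutoff (c * w) * ha w) +
        (c * wz cutoff (c * w) * hb w + 1 * cutoff (c * w) * hab w)) +
        conj w * (c * wzbar cutoff (c * w) * h w + 1 * cutoff (c * w) * hb w) := by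
      rw [diffExpr₁, hwb, hw2]
      simp only [hha, hhb, hhab, hh]
      ring
    rw [hD]
    have b1 := norm_mul_le_of_le_one (c := h w) hcc1 (n3.trans m3)
    have b2 := norm_mul_le_of_le_one (c := ha w) hc1 (n2.trans m2)
    have b3 := norm_mul_le_of_le_one (c := hb w) hc1 (n1.trans m1)
    have b4 := norm_mul_le_of_le_one (c := hab w) one1 (n0.trans m0)
    have b5 := norm_mul_le_of_le_one (c := h w) hc1 (n2.trans m2)
    have b6 := norm_mul_le_of_le_one (c := hb w) one1 (n0.trans m0)
    refine (norm_add_le _ _).trans ?_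
    rw [norm_neg, norm_mul (conj w), RCLike.norm_conj]
    have s1 := (norm_add_le ((c * c) * wz (wzbar cutoff) (c * w) * h w +
      c * wzbar cutoff (c * w) * ha w) (c * wz cutoff (c * w) * hb w + 1 * cutoff (c * w) * hab w))
    have s2 := norm_add_le ((c * c) * wz (wzbar cutoff) (c * w) * h w)
      (c * wzbar cutoff (c * w) * ha w)
    have s3 := norm_add_le (c * wz cutoff (c * w) * hb w) (1 * cutoff (c * w) * hab w)
    have s4 := norm_add_le (c * wzbar cutoff (c * w) * h w) (1 * cutoff (c * w) * hb w)
    have s5 := mul_le_mul_of_nonneg_left (s4.trans (add_le_add b5 b6)) (norm_nonneg w)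
    linarith

/-! ### The graph of the magnetic Laplacian -/

/-- The Landau level of a basis function. -/
def level (a : Idx n) : ℕ := ∑ j, a.1 j

theorem hasWirtinger_of_contDiff {f : ℂ → ℂ} (hf : ContDiff ℝ ∞ f) (w : ℂ) :
    HasWirtinger f (wz f w) (wzbar f w) w :=
  hasWirtinger_of_differentiableAt (hf.differentiable (by simp) w)

theorem diffExpr_prodFun {f : Fin n → ℂ → ℂ} (hf : ∀ j, ContDiff ℝ ∞ (f j)) (z : Cn n) :
    diffExpr (prodFun f) z =
      ∑ j, (∏ i ∈ Finset.univ.erase j, f i (z i)) * diffExpr₁ (f j) (z j) := by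
  have h1 : ∀ j, dZbar j (prodFun f) = prodFun (Function.update f j (wzbar (f j))) := by
    intro j
    funext z
    rw [dZbar_prodFun (fun i => hasWirtinger_of_contDiff (hf i) (z i)), prodFun,
      ← Finset.prod_erase_mul _ _ (Finset.mem_univ j), Function.update_self]
    congr 1
    exact Finset.prod_congr rfl fun i hi => by
      rw [Function.update_of_ne (Finset.ne_of_mem_erase hi)]
  have h2 : ∀ j, ∀ i, ContDiff ℝ ∞ (Function.update f j (wzbar (f j)) i) := by
    intro j i
    rcases eq_or_ne i j with rfl | hij
    · rw [Function.update_self]; exact contDiff_wzbar (hf i)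
    · rw [Function.update_of_ne hij]; exact hf i
  rw [diffExpr, ← Finset.sum_neg_distrib, ← Finset.sum_add_distrib]
  refine Finset.sum_congr rfl fun j _ => ?_
  rw [dZbar_prodFun (fun i => hasWirtinger_of_contDiff (hf i) (z i)), h1,
    dZ_prodFun (fun i => hasWirtinger_of_contDiff (h2 j i) (z i)), Function.update_self, diffExpr₁]
  have h3 : ∏ i ∈ Finset.univ.erase j, Function.update f j (wzbar (f j)) i (z i) =
      ∏ i ∈ Finset.univ.erase j, f i (z i) :=
    Finset.prod_congr rfl fun i hi => by rw [Function.update_of_ne (Finset.ne_of_mem_erase hi)]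
  rw [h3]
  ring

theorem prodFun_mem {f : Fin n → ℂ → ℂ} (hf : ∀ j, ContDiff ℝ ∞ (f j))
    (hs : ∀ j, HasCompactSupport (f j)) : prodFun f ∈ testFun n := by
  constructor
  · exact contDiff_prod fun j _ => (hf j).comp (contDiff_apply ℝ ℂ j)
  · refine HasCompactSupport.intro (isCompact_univ_pi fun j => (hs j).isCompact) fun z hz => ?_
    rw [Set.mem_univ_pi] at hz
    push Not at hz
    obtain ⟨j, hj⟩ := hz
    exact Finset.prod_eq_zero (Finset.mem_univ j) (image_eq_zero_of_notMem_tsupport hj)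

/-- The cutoffs of the Hermite functions. -/
def cutHermite (a : Idx n) (k : ℕ) : testFun n :=
  ⟨prodFun fun j => cutAt k (cHermite (a.1 j) (a.2 j)),
    prodFun_mem (fun _ => contDiff_cutAt k (contDiff_cHermite _ _))
      fun _ => hasCompactSupport_cutAt k _⟩

theorem tendsto_toLp_of_dominated {F : ℕ → Cn n → ℂ} {G B : Cn n → ℂ}
    (hF : ∀ k, MemLp (F k) 2 (gaussianMeasure n)) (hG : MemLp G 2 (gaussianMeasure n))
    (hB : MemLp B 2 (gaussianMeasure n)) (hb : ∀ k z, ‖F k z‖ ≤ ‖B z‖)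
    (hl : ∀ z, Tendsto (fun k => F k z) atTop (𝓝 (G z))) :
    Tendsto (fun k => (hF k).toLp (F k)) atTop (𝓝 (hG.toLp G)) := by
  rw [tendsto_iff_norm_sub_tendsto_zero]
  have hbG : ∀ z, ‖G z‖ ≤ ‖B z‖ := fun z =>
    le_of_tendsto (hl z).norm (Eventually.of_forall fun k => hb k z)
  have h0 : Tendsto (fun k => ‖(hF k).toLp (F k) - hG.toLp G‖ ^ 2) atTop (𝓝 0) := by
    have h1 : ∀ k, ‖(hF k).toLp (F k) - hG.toLp G‖ ^ 2 =
        ∫ z, ‖F k z - G z‖ ^ 2 ∂(gaussianMeasure n) := by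
      intro k
      rw [← MemLp.toLp_sub, norm_sq_toLp]
      rfl
    simp only [h1]
    have h2 := tendsto_integral_of_dominated_convergence (μ := gaussianMeasure n)
      (F := fun k z => ‖F k z - G z‖ ^ 2) (f := fun _ => (0 : ℝ)) (fun z => 4 * ‖B z‖ ^ 2)
      (fun k => (continuous_pow 2).comp_aestronglyMeasurable ((hF k).1.sub hG.1).norm)
      (((memLp_two_iff_integrable_sq_norm hB.1).1 hB).const_mul 4)
      (fun k => Eventually.of_forall fun z => by
        rw [Real.norm_of_nonneg (by positivity)]
        have h3 : ‖F k z - G z‖ ≤ 2 * ‖B z‖ :=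
          (norm_sub_le _ _).trans (by linarith [hb k z, hbG z])
        nlinarith [norm_nonneg (F k z - G z)])
      (Eventually.of_forall fun z => by
        have h4 := (((hl z).sub_const (G z)).norm.pow 2)
        simpa using h4)
    simpa using h2
  have := (Real.continuous_sqrt.tendsto 0).comp h0
  simpa [Function.comp_def, Real.sqrt_sq] using this

theorem testToL2_mem_graph (f : testFun n) :
    (testToL2 n f, testToL2 n (testOp n f)) ∈ (minimalOp n).graph := by
  rw [LinearPMap.mem_graph_iff]
  refine ⟨⟨testToL2 n f, LinearMap.mem_range_self _ f⟩, rfl, ?_⟩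
  change testToL2 n (testOp n ((LinearEquiv.ofInjective _ (testToL2_injective n)).symm _)) = _
  congr 2
  exact (LinearEquiv.ofInjective (testToL2 n) (testToL2_injective n)).symm_apply_apply f

theorem exists_of_mem_graph {p : L2 n × L2 n} (hp : p ∈ (minimalOp n).graph) :
    ∃ f : testFun n, p = (testToL2 n f, testToL2 n (testOp n f)) := by
  obtain ⟨⟨x, f, hf⟩, hx, hy⟩ := (LinearPMap.mem_graph_iff _).1 hp
  refine ⟨f, ?_⟩
  have h := testToL2_mem_graph f
  simp only at hx
  rw [hf, hx] at h
  rw [hf, hx]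
  exact Prod.ext rfl ((minimalOp n).mem_graph_snd_inj' hp h rfl)

/-- Symmetry passes to limits in one argument at a time. It is stated for the closure of the graph
because closability is deduced from it. -/
theorem inner_eq_of_mem_closure {p r : L2 n × L2 n}
    (hp : p ∈ (minimalOp n).graph.topologicalClosure)
    (hr : r ∈ (minimalOp n).graph.topologicalClosure) :
    inner ℂ r.1 p.2 = inner ℂ r.2 p.1 := by
  have h1 : ∀ r ∈ (minimalOp n).graph, ∀ p ∈ (minimalOp n).graph.topologicalClosure,
      inner ℂ r.1 p.2 = inner ℂ r.2 p.1 := by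
    intro r hr p hp
    have hc : IsClosed {p : L2 n × L2 n | inner ℂ r.1 p.2 = inner ℂ r.2 p.1} :=
      isClosed_eq (by fun_prop) (by fun_prop)
    refine closure_minimal (fun p hp => ?_) hc hp
    obtain ⟨f, rfl⟩ := exists_of_mem_graph hp
    obtain ⟨g, rfl⟩ := exists_of_mem_graph hr
    exact inner_testOp_eq f g
  have hc : IsClosed {r : L2 n × L2 n | inner ℂ r.1 p.2 = inner ℂ r.2 p.1} :=
    isClosed_eq (by fun_prop) (by fun_prop)
  exact closure_minimal (fun r hr => h1 r hr p hp) hc hr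

theorem norm_prodFun_le {f B : Fin n → ℂ → ℂ} {z : Cn n}
    (h : ∀ j, ‖f j (z j)‖ ≤ ‖B j (z j)‖) : ‖prodFun f z‖ ≤ ‖prodFun B z‖ := by
  rw [prodFun, prodFun, norm_prod, norm_prod]
  exact Finset.prod_le_prod (fun _ _ => norm_nonneg _) fun j _ => h j

/-- The cutoffs converge in the graph norm: at each point they and their images are eventually
constant, and the growth bounds of `cutAt_cHermite_bound` allow dominated convergence. -/
theorem hermite_mem_closure (a : Idx n) :
    ((memLp_hermite a).toLp (hermite a), (level a : ℂ) • (memLp_hermite a).toLp (hermite a)) ∈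
      (minimalOp n).graph.topologicalClosure := by
  choose B hBt hB using fun j => cutAt_cHermite_bound (a.1 j) (a.2 j)
  have hc : ∀ k j, ContDiff ℝ ∞ (cutAt k (cHermite (a.1 j) (a.2 j))) := fun k j =>
    contDiff_cutAt k (contDiff_cHermite _ _)
  have hev : ∀ z : Cn n, ∀ᶠ k in atTop, ∀ j,
      cutAt k (cHermite (a.1 j) (a.2 j)) =ᶠ[𝓝 (z j)] cHermite (a.1 j) (a.2 j) := fun z =>
    eventually_all.2 fun j => cutAt_eventuallyEq _ _
  have h1 : Tendsto (fun k => testToL2 n (cutHermite a k)) atTop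
      (𝓝 ((memLp_hermite a).toLp (hermite a))) := by
    refine tendsto_toLp_of_dominated (B := prodFun B) (fun k => memLp_of_mem (cutHermite a k).2)
      (memLp_hermite a) (memLp_prodFun hBt) (fun k z => ?_) fun z => ?_
    · exact norm_prodFun_le fun j => (hB j k (z j)).1
    · refine tendsto_const_nhds.congr' ?_
      filter_upwards [hev z] with k hk
      change prodFun _ z = prodFun _ z
      exact Finset.prod_congr rfl fun j _ => (hk j).eq_of_nhds.symm
  have h2 : Tendsto (fun k => testToL2 n (testOp n (cutHermite a k))) atTop
      (𝓝 ((level a : ℂ) • (memLp_hermite a).toLp (hermite a))) := by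
    rw [← MemLp.toLp_const_smul]
    -- The factor `n` counts the summands of the differential expression, each bounded by `prodFun
    -- B`.
    refine tendsto_toLp_of_dominated (B := (n : ℂ) • prodFun B)
      (fun k => memLp_of_mem (testOp n (cutHermite a k)).2)
      ((memLp_hermite a).const_smul _) ((memLp_prodFun hBt).const_smul _) (fun k z => ?_)
      fun z => ?_
    · change ‖diffExpr (prodFun _) z‖ ≤ _
      rw [diffExpr_prodFun (hc k)]
      refine (norm_sum_le _ _).trans ?_
      have : ‖((n : ℂ) • prodFun B) z‖ = ∑ j : Fin n, ‖prodFun B z‖ := by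
        simp
      rw [this]
      refine Finset.sum_le_sum fun j _ => ?_
      rw [norm_mul, norm_prod, prodFun, norm_prod, ← Finset.prod_erase_mul _ _ (Finset.mem_univ j)]
      exact mul_le_mul (Finset.prod_le_prod (fun _ _ => norm_nonneg _)
        fun i _ => (hB i k (z i)).1) (hB j k (z j)).2 (norm_nonneg _)
        (Finset.prod_nonneg fun _ _ => norm_nonneg _)
    · refine tendsto_const_nhds.congr' ?_
      filter_upwards [hev z] with k hk
      change (level a : ℂ) * prodFun _ z = diffExpr (prodFun _) z
      rw [diffExpr_prodFun (hc k), level, Nat.cast_sum, Finset.sum_mul]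
      refine Finset.sum_congr rfl fun j _ => ?_
      rw [diffExpr₁_congr (hk j), diffExpr₁_cHermite, prodFun,
        ← Finset.prod_erase_mul _ _ (Finset.mem_univ j),
        Finset.prod_congr rfl fun i _ => (hk i).eq_of_nhds]
      ring
  exact mem_closure_of_tendsto (h1.prodMk_nhds h2)
    (Eventually.of_forall fun k => testToL2_mem_graph (cutHermite a k))

theorem landauBasis_mem_closure (a : Idx n) :
    (landauBasis n a, (level a : ℂ) • landauBasis n a) ∈
      (minimalOp n).graph.topologicalClosure := by
  have h := Submodule.smul_mem _ (((Real.sqrt (hermiteNormSq a))⁻¹ : ℝ) : ℂ) (hermite_mem_closure a)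
  have e : landauBasis n a =
      (((Real.sqrt (hermiteNormSq a))⁻¹ : ℝ) : ℂ) • (memLp_hermite a).toLp (hermite a) := by
    rw [landauBasis_apply, ← MemLp.toLp_const_smul]
    rfl
  rw [e, smul_comm]
  exact h

theorem inner_of_mem_closure {x y : L2 n} (h : (x, y) ∈ (minimalOp n).graph.topologicalClosure)
    (a : Idx n) : inner ℂ (landauBasis n a) y = (level a : ℂ) * inner ℂ (landauBasis n a) x := by
  have := inner_eq_of_mem_closure h (landauBasis_mem_closure a)
  simpa [inner_smul_left] using this

/-- The partial sums of the expansions of `x` and `y` form pairs in the closed graph, by linearity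
from the basis vectors, and they converge to `(x, y)`. -/
theorem mem_closure_of_inner {x y : L2 n}
    (h : ∀ a, inner ℂ (landauBasis n a) y = (level a : ℂ) * inner ℂ (landauBasis n a) x) :
    (x, y) ∈ (minimalOp n).graph.topologicalClosure := by
  have hx := (landauBasis n).hasSum_repr x
  have hy := (landauBasis n).hasSum_repr y
  refine (Submodule.isClosed_topologicalClosure _).mem_of_tendsto (hx.prodMk hy) (Eventually.of_forall fun s => ?_)
  refine Submodule.sum_mem _ fun a _ => ?_
  have := Submodule.smul_mem _ ((landauBasis n).repr x a) (landauBasis_mem_closure a)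
  rw [Prod.smul_mk, smul_smul] at this
  rw [HilbertBasis.repr_apply_apply _ y, h, mul_comm, ← HilbertBasis.repr_apply_apply]
  exact this

/-- If `(0, y)` is a limit of graph points then all coordinates of `y` vanish. Closability matters
because `LinearPMap.closure` returns a non-closable operator unchanged. -/
theorem isClosable_minimalOp (n : ℕ) : (minimalOp n).IsClosable := by
  refine ⟨(minimalOp n).graph.topologicalClosure.toLinearPMap, ?_⟩
  rw [Submodule.toLinearPMap_graph_eq]
  rintro ⟨x, y⟩ hxy hx
  simp only at hx ⊢
  subst hx
  refine hilbertBasis_ext (landauBasis n) fun a => ?_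
  rw [inner_of_mem_closure hxy, inner_zero_right, mul_zero]

/-- The magnetic Laplacian is diagonal in the basis of complex Hermite polynomials. -/
theorem mem_graph_magneticLaplacian_iff (x y : L2 n) :
    (x, y) ∈ (magneticLaplacian n).graph ↔
      ∀ a, inner ℂ (landauBasis n a) y = (level a : ℂ) * inner ℂ (landauBasis n a) x := by
  rw [magneticLaplacian, ← (isClosable_minimalOp n).graph_closure_eq_closure_graph]
  exact ⟨fun h => inner_of_mem_closure h, mem_closure_of_inner⟩

/-- The spectral family of the magnetic Laplacian. -/
def landauFamily (n : ℕ) : SpectralFamily (L2 n) := .ofEigenbasis (landauBasis n) level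

theorem landauFamily_decomposes (n : ℕ) : (landauFamily n).Decomposes (magneticLaplacian n) :=
  SpectralFamily.ofEigenbasis_decomposes _ _ _ mem_graph_magneticLaplacian_iff

theorem eq_landauFamily {E : SpectralFamily (L2 n)} (hE : E.Decomposes (magneticLaplacian n)) :
    E = landauFamily n := by
  refine hE.eq_of_eigenbasis (landauFamily_decomposes n) (landauBasis n) (fun a => (level a : ℝ))
    fun a => ?_
  rw [mem_graph_magneticLaplacian_iff]
  intro b
  rw [inner_smul_right, Complex.ofReal_natCast]
  classical
  rw [inner_hilbertBasis]
  split_ifs with h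
  · rw [h]
  · simp

/-! ### Counting Landau levels -/

theorem card_piAntidiag_univ (n k : ℕ) :
    (Finset.piAntidiag (Finset.univ : Finset (Fin n)) k).card = n.multichoose k := by
  rw [← Finset.map_sym_eq_piAntidiag, Finset.card_map, Finset.sym_univ, Finset.card_univ,
    Sym.card_sym_eq_multichoose, Fintype.card_fin]

/-- The multi-indices of order at most `m`. -/
def multiIdx (n m : ℕ) : Finset (Fin n → ℕ) :=
  (Finset.range (m + 1)).biUnion fun k => Finset.piAntidiag Finset.univ k

theorem mem_multiIdx {m : ℕ} {q : Fin n → ℕ} : q ∈ multiIdx n m ↔ ∑ j, q j ≤ m := by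
  simp [multiIdx]

/-- Multi-indices of fixed order form disjoint shells, whose sizes add up by the hockey-stick
identity. -/
theorem card_multiIdx (n m : ℕ) : (multiIdx n m).card = (m + n).choose n := by
  rw [multiIdx, Finset.card_biUnion]
  · simp only [card_piAntidiag_univ]
    exact Nat.sum_range_multichoose m n
  · intro k _ l _ hkl
    rw [Function.onFun, Finset.disjoint_left]
    intro q hq hq'
    simp only [Finset.mem_piAntidiag] at hq hq'
    exact hkl (hq.1.symm.trans hq'.1)

/-- The Landau levels up to `t`, in each variable. -/
def levelSet (n : ℕ) (t : ℝ) : Finset (Fin n → ℕ) := if 0 ≤ t then multiIdx n ⌊t⌋₊ else ∅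

theorem mem_levelSet {t : ℝ} {a : Idx n} : a.1 ∈ levelSet n t ↔ (level a : ℝ) ≤ t := by
  rw [levelSet]
  split_ifs with h
  · rw [mem_multiIdx, Nat.le_floor_iff h, level]
  · refine iff_of_false (Finset.notMem_empty _) fun h' => h ((Nat.cast_nonneg _).trans h')

/-- The density of states, as the number of Landau levels up to `t` divided by `πⁿ`. -/
theorem card_levelSet_div (n : ℕ) (t : ℝ) : ((levelSet n t).card : ℝ) / Real.pi ^ n =
    if 0 ≤ t then
      ((⌊t⌋₊ + n).factorial : ℝ) / (Real.pi ^ n * (⌊t⌋₊.factorial : ℝ) * (n.factorial : ℝ))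
    else 0 := by
  rw [levelSet]
  split_ifs with h
  · rw [card_multiIdx, Nat.cast_choose ℝ (Nat.le_add_left n ⌊t⌋₊), Nat.add_sub_cancel, div_div]
    congr 1
    ring
  · simp

/-! ### The kernels of the spectral projections -/

/-- The kernel of the projection onto the level `q j` in each variable. -/
def prodKernel (q : Fin n → ℕ) (z w : Cn n) : ℂ := prodFun (fun j => levelKernel (q j) (z j)) w

/-- The kernel of the spectral projection for `(-∞, t]`. -/
def landauKernel (t : ℝ) (z w : Cn n) : ℂ := ∑ q ∈ levelSet n t, prodKernel q z w

theorem memLp_prodKernel (q : Fin n → ℕ) (z : Cn n) :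
    MemLp (prodKernel q z) 2 (gaussianMeasure n) :=
  memLp_prodFun fun _ => tame_levelKernel _ _

theorem memLp_landauKernel (t : ℝ) (z : Cn n) :
    MemLp (landauKernel t z) 2 (gaussianMeasure n) := by
  have := memLp_finsetSum (μ := gaussianMeasure n) (p := 2) (levelSet n t)
    fun q _ => memLp_prodKernel q z
  exact this

theorem continuous_prodKernel (q : Fin n → ℕ) :
    Continuous fun p : Cn n × Cn n => prodKernel q p.1 p.2 := by
  have h : ∀ j, Continuous fun p : Cn n × Cn n => levelKernel (q j) (p.1 j) (p.2 j) := fun j =>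
    (continuous_levelKernel (q j)).comp (f := fun p : Cn n × Cn n => (p.1 j, p.2 j)) (by fun_prop)
  exact continuous_finsetProd Finset.univ fun j _ => h j

theorem continuous_landauKernel (t : ℝ) :
    Continuous fun p : Cn n × Cn n => landauKernel t p.1 p.2 :=
  continuous_finsetSum (levelSet n t) fun q _ => continuous_prodKernel q

theorem exp_sqNorm (z : Cn n) : (Real.exp (sqNorm z) : ℂ) = ∏ j, Complex.exp (z j * conj (z j)) := by
  rw [← Complex.exp_sum, Complex.ofReal_exp, sqNorm]
  congr 1
  rw [Complex.ofReal_sum]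
  refine Finset.sum_congr rfl fun j _ => ?_
  rw [Complex.mul_conj', Complex.ofReal_pow]

/-- Each multi-index contributes the same amount `e^{|z|²}/πⁿ`, so only their number remains. -/
theorem landauKernel_self (t : ℝ) (z : Cn n) :
    landauKernel t z z =
      (((levelSet n t).card : ℝ) / Real.pi ^ n * Real.exp (sqNorm z) : ℝ) := by
  have h : ∀ q : Fin n → ℕ, prodKernel q z z = (Real.exp (sqNorm z) : ℂ) / Real.pi ^ n := by
    intro q
    simp only [prodKernel, prodFun, levelKernel_self]
    rw [Finset.prod_div_distrib, exp_sqNorm]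
    simp
  simp only [landauKernel, h]
  rw [Finset.sum_const, nsmul_eq_mul]
  push_cast
  ring

theorem integral_prodKernel_mul_basisFun (q : Fin n → ℕ) (z : Cn n) (a : Idx n) :
    ∫ w, prodKernel q z w * basisFun a w ∂(gaussianMeasure n) =
      if a.1 = q then basisFun a z else 0 := by
  have h : ∀ w, prodKernel q z w * basisFun a w = ((Real.sqrt (hermiteNormSq a))⁻¹ : ℝ) *
      prodFun (fun j w => levelKernel (q j) (z j) w * cHermite (a.1 j) (a.2 j) w) w := by
    intro w
    simp only [prodKernel, basisFun, hermite, prodFun, Finset.prod_mul_distrib]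
    ring
  simp only [h]
  rw [integral_const_mul, integral_prodFun]
  simp only [gint_levelKernel_mul_cHermite]
  split_ifs with hq
  · subst hq
    simp [basisFun, hermite, prodFun]
  · obtain ⟨j, hj⟩ : ∃ j, ¬(q j = a.1 j) := by
      by_contra hc
      push Not at hc
      exact hq (funext fun j => (hc j).symm)
    rw [Finset.prod_eq_zero (Finset.mem_univ j) (if_neg hj), mul_zero]

theorem integrable_mul_basisFun {f : Cn n → ℂ} (hf : MemLp f 2 (gaussianMeasure n)) (a : Idx n) :
    Integrable (fun w => f w * basisFun a w) (gaussianMeasure n) :=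
  hf.integrable_mul (memLp_basisFun a)

theorem integral_landauKernel_mul_basisFun (t : ℝ) (z : Cn n) (a : Idx n) :
    ∫ w, landauKernel t z w * basisFun a w ∂(gaussianMeasure n) =
      if (level a : ℝ) ≤ t then basisFun a z else 0 := by
  simp only [landauKernel, Finset.sum_mul]
  rw [integral_finsetSum _ fun q _ => integrable_mul_basisFun (memLp_prodKernel q z) a]
  simp only [integral_prodKernel_mul_basisFun, Finset.sum_ite_eq, mem_levelSet]

theorem landauBasis_coeFn (a : Idx n) : landauBasis n a =ᵐ[gaussianMeasure n] basisFun a := by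
  rw [landauBasis_apply]
  exact (memLp_basisFun a).coeFn_toLp

/-- The vector that represents integration against `f`. -/
def conjVec {f : Cn n → ℂ} (hf : MemLp f 2 (gaussianMeasure n)) : L2 n :=
  (hf.star).toLp (star f)

theorem inner_conjVec {f : Cn n → ℂ} (hf : MemLp f 2 (gaussianMeasure n)) (φ : L2 n) :
    inner ℂ (conjVec hf) φ = ∫ w, f w * φ w ∂(gaussianMeasure n) := by
  rw [conjVec, inner_toLp_left]
  simp

theorem inner_conjVec_landauBasis {f : Cn n → ℂ} (hf : MemLp f 2 (gaussianMeasure n)) (a : Idx n) :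
    inner ℂ (conjVec hf) (landauBasis n a) = ∫ w, f w * basisFun a w ∂(gaussianMeasure n) := by
  rw [inner_conjVec]
  refine integral_congr_ae ?_
  filter_upwards [landauBasis_coeFn a] with w hw
  rw [hw]

/-- A kernel with the right action on the basis functions is the kernel of the projection. -/
theorem projOn_apply_ae (s : Set (Idx n)) [DecidablePred (· ∈ s)] {K : Cn n → Cn n → ℂ}
    (hK : ∀ z, MemLp (K z) 2 (gaussianMeasure n))
    (h : ∀ z a, ∫ w, K z w * basisFun a w ∂(gaussianMeasure n) = if a ∈ s then basisFun a z else 0)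
    (φ : L2 n) :
    projOn (landauBasis n) s φ =ᵐ[gaussianMeasure n] fun z => ∫ w, K z w * φ w ∂(gaussianMeasure n) := by
  set b := landauBasis n with hb
  -- Convergence of the basis expansion in `L²` gives convergence almost everywhere along a sequence
  -- of finite index sets.
  have hm : TendstoInMeasure (gaussianMeasure n)
      (fun u : Finset (Idx n) => ((∑ a ∈ u, b.repr (projOn b s φ) a • b a : L2 n) : Cn n → ℂ)) atTop
      (projOn b s φ) := tendstoInMeasure_of_tendsto_Lp (b.hasSum_repr (projOn b s φ))
  obtain ⟨ns, hns, hae⟩ := hm.exists_seq_tendsto_ae'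
  have hsum : ∀ u : Finset (Idx n), ((∑ a ∈ u, b.repr (projOn b s φ) a • b a : L2 n) : Cn n → ℂ)
      =ᵐ[gaussianMeasure n] fun z => ∑ a ∈ u, b.repr (projOn b s φ) a * basisFun a z := by
    intro u
    have h1 := Lp.coeFn_finsetSum u fun a => b.repr (projOn b s φ) a • b a
    have h2 : ∀ᵐ z ∂(gaussianMeasure n), ∀ a : Idx n,
        (b.repr (projOn b s φ) a • b a : L2 n) z = b.repr (projOn b s φ) a * basisFun a z := by
      refine ae_all_iff.2 fun a => ?_
      filter_upwards [Lp.coeFn_smul (b.repr (projOn b s φ) a) (b a), landauBasis_coeFn a] with z h3 h4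
      rw [h3, Pi.smul_apply, smul_eq_mul, h4]
    filter_upwards [h1, h2] with z h3 h4
    rw [h3, Finset.sum_apply]
    exact Finset.sum_congr rfl fun a _ => h4 a
  have hall : ∀ᵐ z ∂(gaussianMeasure n), ∀ k,
      ((∑ a ∈ ns k, b.repr (projOn b s φ) a • b a : L2 n) : Cn n → ℂ) z =
        ∑ a ∈ ns k, b.repr (projOn b s φ) a * basisFun a z := ae_all_iff.2 fun k => hsum (ns k)
  filter_upwards [hae, hall] with z h1 h2
  -- At a fixed point `z` the same series converges to the integral, by Parseval for `K z` and `φ`;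
  -- the two limits must agree.
  have h3 : HasSum (fun a => b.repr (projOn b s φ) a * basisFun a z)
      (∫ w, K z w * φ w ∂(gaussianMeasure n)) := by
    rw [← inner_conjVec (hK z)]
    refine HasSum.congr_term (b.hasSum_inner_mul_inner (conjVec (hK z)) φ) fun a => ?_
    rw [inner_conjVec_landauBasis, h, b.repr_apply_apply, inner_projOn]
    split_ifs
    · ring
    · simp
  refine tendsto_nhds_unique h1 ?_
  simp only [h2]
  exact h3.comp hns

theorem isContinuousKernel_landauKernel (t : ℝ) :
    IsContinuousKernel ((landauFamily n).proj t) (landauKernel t) := by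
  classical
  refine ⟨continuous_landauKernel t, memLp_landauKernel t, fun φ => ?_⟩
  rw [landauFamily, SpectralFamily.ofEigenbasis_proj]
  exact projOn_apply_ae _ (memLp_landauKernel t) (integral_landauKernel_mul_basisFun t) φ

/-- An operator has at most one continuous kernel. -/
theorem IsContinuousKernel.unique {P : L2 n →L[ℂ] L2 n} {K K' : Cn n → Cn n → ℂ}
    (hK : IsContinuousKernel P K) (hK' : IsContinuousKernel P K') : K = K' := by
  -- Since the basis is countable, one null set of `z` serves all coordinates. Continuity in `w`,
  -- and then in `z`, removes the exceptional sets.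
  have h1 : ∀ᵐ z ∂(gaussianMeasure n), ∀ a : Idx n,
      ∫ w, K z w * landauBasis n a w ∂(gaussianMeasure n) =
        ∫ w, K' z w * landauBasis n a w ∂(gaussianMeasure n) := by
    refine ae_all_iff.2 fun a => ?_
    filter_upwards [hK.apply_ae (landauBasis n a), hK'.apply_ae (landauBasis n a)] with z h1 h2
    rw [← h1, ← h2]
  have h2 : ∀ᵐ z ∂(gaussianMeasure n), ∀ w, K z w = K' z w := by
    filter_upwards [h1] with z hz
    have h3 : conjVec (hK.memLp z) = conjVec (hK'.memLp z) := by
      refine hilbertBasis_ext (landauBasis n) fun a => ?_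
      rw [← inner_conj_symm, inner_conjVec, hz, ← inner_conjVec (hK'.memLp z), inner_conj_symm]
    rw [conjVec, conjVec, MemLp.toLp_eq_toLp_iff] at h3
    have h4 : K z =ᵐ[gaussianMeasure n] K' z := by
      filter_upwards [h3] with w hw
      exact star_injective hw
    have c : ∀ {K}, IsContinuousKernel P K → Continuous (K z) := fun {K} h =>
      h.continuous.comp (continuous_const.prodMk continuous_id)
    exact congrFun ((Continuous.ae_eq_iff_eq _ (c hK) (c hK')).1 h4)
  funext z w
  have c : ∀ {K}, IsContinuousKernel P K → Continuous fun z => K z w := fun {K} h =>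
    h.continuous.comp (continuous_id.prodMk continuous_const)
  have h5 : (fun z => K z w) =ᵐ[gaussianMeasure n] fun z => K' z w := by
    filter_upwards [h2] with z hz
    exact hz w
  exact congrFun ((Continuous.ae_eq_iff_eq _ (c hK) (c hK')).1 h5) z

/-! ### The density of states -/

/-- The exponential cancels the Gaussian weight and leaves Lebesgue measure. -/
theorem setLIntegral_exp_sqNorm {Ω : Set (Cn n)} (hΩ : MeasurableSet Ω) :
    ∫⁻ z in Ω, ENNReal.ofReal (Real.exp (sqNorm z)) ∂(gaussianMeasure n) = volume Ω := by
  have hm : Measurable fun z : Cn n => ENNReal.ofReal (Real.exp (-sqNorm z)) :=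
    (Real.continuous_exp.comp (continuous_sqNorm n).neg).measurable.ennreal_ofReal
  have hm' : Measurable fun z : Cn n => ENNReal.ofReal (Real.exp (sqNorm z)) :=
    (Real.continuous_exp.comp (continuous_sqNorm n)).measurable.ennreal_ofReal
  rw [gaussianMeasure, restrict_withDensity hΩ, lintegral_withDensity_eq_lintegral_mul _ hm hm']
  have : ∀ z : Cn n, ((fun z : Cn n => ENNReal.ofReal (Real.exp (-sqNorm z))) *
      (fun z : Cn n => ENNReal.ofReal (Real.exp (sqNorm z))) : Cn n → ENNReal) z = 1 := by
    intro z
    rw [Pi.mul_apply, ← ENNReal.ofReal_mul (Real.exp_pos _).le, ← Real.exp_add]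
    simp
  rw [lintegral_congr this, lintegral_one, Measure.restrict_apply_univ]

theorem integrableOn_exp_sqNorm {Ω : Set (Cn n)} (hΩ : MeasurableSet Ω) (hv : volume Ω ≠ ⊤) :
    IntegrableOn (fun z => Real.exp (sqNorm z)) Ω (gaussianMeasure n) := by
  refine ⟨(Real.continuous_exp.comp (continuous_sqNorm n)).aestronglyMeasurable, ?_⟩
  rw [hasFiniteIntegral_iff_ofReal (Eventually.of_forall fun z => (Real.exp_pos _).le),
    setLIntegral_exp_sqNorm hΩ]
  exact hv.lt_top

theorem setIntegral_exp_sqNorm {Ω : Set (Cn n)} (hΩ : MeasurableSet Ω) :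
    ∫ z in Ω, Real.exp (sqNorm z) ∂(gaussianMeasure n) = volume.real Ω := by
  rw [integral_eq_lintegral_of_nonneg_ae (Eventually.of_forall fun z => (Real.exp_pos _).le)
    (Real.continuous_exp.comp (continuous_sqNorm n)).aestronglyMeasurable,
    setLIntegral_exp_sqNorm hΩ, Measure.real]

theorem hasKernelDensity_landauFamily (t : ℝ) :
    HasKernelDensity ((landauFamily n).proj t) ((levelSet n t).card / Real.pi ^ n) := by
  refine ⟨⟨_, isContinuousKernel_landauKernel t⟩, fun K hK Ω hΩ h0 hv => ?_⟩
  rw [hK.unique (isContinuousKernel_landauKernel t)]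
  simp only [landauKernel_self]
  refine ⟨((integrableOn_exp_sqNorm hΩ hv).const_mul _).ofReal, ?_⟩
  rw [integral_complex_ofReal, integral_const_mul, setIntegral_exp_sqNorm hΩ, ← Complex.ofReal_div,
    mul_div_assoc, div_self, mul_one]
  rw [Measure.real]
  exact (ENNReal.toReal_pos h0 hv).ne'

/-- Parseval's identity for the kernel of a single level. -/
theorem hasSum_sq_norm_basisFun_level (q : Fin n → ℕ) (z : Cn n) :
    HasSum (fun a : Idx n => if a.1 = q then ‖basisFun a z‖ ^ 2 else 0)
      (Real.exp (sqNorm z) / Real.pi ^ n) := by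
  have hK := memLp_prodKernel q z
  have h1 := hasSum_sq_norm_inner (landauBasis n) (conjVec hK)
  have h2 : ‖conjVec hK‖ ^ 2 = Real.exp (sqNorm z) / Real.pi ^ n := by
    have h3 : ∫ w, conj (prodKernel q z w) * prodKernel q z w ∂(gaussianMeasure n) =
        ((Real.exp (sqNorm z) / Real.pi ^ n : ℝ) : ℂ) := by
      simp only [prodKernel]
      rw [integral_conj_prodFun_mul]
      simp only [gint_conj_levelKernel_mul_self]
      rw [Finset.prod_div_distrib, ← exp_sqNorm]
      simp
    have h4 : ∀ w, conj (prodKernel q z w) * prodKernel q z w =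
        ((‖star (prodKernel q z) w‖ ^ 2 : ℝ) : ℂ) := by
      intro w
      rw [RCLike.conj_mul, Pi.star_apply, norm_star]
      push_cast
      rfl
    simp only [h4] at h3
    rw [integral_complex_ofReal, ← norm_sq_toLp hK.star] at h3
    exact Complex.ofReal_injective h3
  rw [h2] at h1
  -- By the reproducing property the coordinates of the conjugated kernel are `conj (basisFun a z)`
  -- on the level `q` and zero elsewhere.
  refine HasSum.congr_term h1 fun a => ?_
  rw [← norm_inner_symm, inner_conjVec_landauBasis, integral_prodKernel_mul_basisFun]
  split_ifs <;> simp

theorem hasSum_sq_norm_basisFun (t : ℝ) (z : Cn n) :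
    HasSum (fun a : Idx n => if (level a : ℝ) ≤ t then ‖basisFun a z‖ ^ 2 else 0)
      ((levelSet n t).card / Real.pi ^ n * Real.exp (sqNorm z)) := by
  have h := hasSum_sum (s := levelSet n t) fun q _ => hasSum_sq_norm_basisFun_level q z
  simp only [Finset.sum_ite_eq, mem_levelSet, Finset.sum_const, nsmul_eq_mul] at h
  convert! h using 1
  ring

theorem mulChar_coeFn (Ω : Set (Cn n)) (hΩ : MeasurableSet Ω) (f : L2 n) :
    mulChar Ω hΩ f =ᵐ[gaussianMeasure n] Ω.indicator f :=
  ((Lp.memLp f).indicator hΩ).coeFn_toLp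

theorem inner_mulChar (Ω : Set (Cn n)) (hΩ : MeasurableSet Ω) (f g : L2 n) :
    inner ℂ f (mulChar Ω hΩ g) = inner ℂ (mulChar Ω hΩ f) g := by
  rw [L2.inner_def, L2.inner_def]
  refine integral_congr_ae ?_
  filter_upwards [mulChar_coeFn Ω hΩ f, mulChar_coeFn Ω hΩ g] with z h1 h2
  rw [h1, h2]
  by_cases h : z ∈ Ω <;> simp [h]

theorem ofReal_norm_sq_mulChar_landauBasis (Ω : Set (Cn n)) (hΩ : MeasurableSet Ω) (a : Idx n) :
    ENNReal.ofReal (‖mulChar Ω hΩ (landauBasis n a)‖ ^ 2) =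
      ∫⁻ z in Ω, ENNReal.ofReal (‖basisFun a z‖ ^ 2) ∂(gaussianMeasure n) := by
  have hm := (memLp_basisFun a).indicator hΩ
  have e : mulChar Ω hΩ (landauBasis n a) = hm.toLp (Ω.indicator (basisFun a)) := by
    refine Lp.ext ?_
    filter_upwards [mulChar_coeFn Ω hΩ (landauBasis n a), hm.coeFn_toLp, landauBasis_coeFn a]
      with z h1 h2 h3
    rw [h1, h2]
    by_cases h : z ∈ Ω <;> simp [h, h3]
  rw [e, norm_sq_toLp, ofReal_integral_eq_lintegral_ofReal
    ((memLp_two_iff_integrable_sq_norm hm.1).1 hm) (Eventually.of_forall fun z => by positivity),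
    ← lintegral_indicator hΩ]
  congr 1
  funext z
  by_cases h : z ∈ Ω <;> simp [h]

theorem inner_proj_self {H : Type} [NormedAddCommGroup H] [InnerProductSpace ℂ H]
    [CompleteSpace H] (E : SpectralFamily H) (t : ℝ) (x : H) :
    inner ℂ x (E.proj t x) = ((‖E.proj t x‖ ^ 2 : ℝ) : ℂ) := by
  have h : inner ℂ (E.proj t x) (E.proj t x) = inner ℂ x (E.proj t (E.proj t x)) :=
    ((E.isStarProjection t).isSelfAdjoint.isSymmetric) x (E.proj t x)
  rw [E.increasing t t le_rfl, inner_self_eq_norm_sq_to_K] at h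
  rw [← h]
  push_cast
  rfl

/-- Parseval in the Landau basis, Tonelli, Parseval in `b`, and Tonelli again reduce the sum to the
integral over `Ω` of `∑ |e_a(z)|²`. Working in `ENNReal` makes the exchanges unconditional, and `b`
is arbitrary, so the trace does not depend on the basis. -/
theorem tsum_ofReal_norm_sq_proj_mulChar (t : ℝ) {Ω : Set (Cn n)} (hΩ : MeasurableSet Ω)
    {ι : Type} (b : HilbertBasis ι ℂ (L2 n)) :
    ∑' i, ENNReal.ofReal (‖(landauFamily n).proj t (mulChar Ω hΩ (b i))‖ ^ 2) =
      ENNReal.ofReal ((levelSet n t).card / Real.pi ^ n) * volume Ω := by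
  classical
  have h1 : ∀ i, ENNReal.ofReal (‖(landauFamily n).proj t (mulChar Ω hΩ (b i))‖ ^ 2) =
      ∑' a : Idx n, if (level a : ℝ) ≤ t then
        ENNReal.ofReal (‖inner ℂ (b i) (mulChar Ω hΩ (landauBasis n a))‖ ^ 2) else 0 := by
    intro i
    have h := hasSum_sq_norm_projOn (landauBasis n) {a | (level a : ℝ) ≤ t} (mulChar Ω hΩ (b i))
    rw [landauFamily, SpectralFamily.ofEigenbasis_proj, ← h.tsum_eq,
      ENNReal.ofReal_tsum_of_nonneg _ h.summable]
    · refine tsum_congr fun a => ?_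
      simp only [Set.mem_ofPred_eq]
      rw [inner_mulChar, norm_inner_symm]
      split_ifs <;> simp
    · intro a
      split_ifs <;> positivity
  have h2 : ∀ a : Idx n, ∑' i, ENNReal.ofReal (‖inner ℂ (b i) (mulChar Ω hΩ (landauBasis n a))‖ ^ 2) =
      ∫⁻ z in Ω, ENNReal.ofReal (‖basisFun a z‖ ^ 2) ∂(gaussianMeasure n) := by
    intro a
    have h := hasSum_sq_norm_inner b (mulChar Ω hΩ (landauBasis n a))
    rw [← ENNReal.ofReal_tsum_of_nonneg (fun i => by positivity) h.summable, h.tsum_eq,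
      ofReal_norm_sq_mulChar_landauBasis]
  have h3 : ∀ a : Idx n, (∑' i, if (level a : ℝ) ≤ t then
        ENNReal.ofReal (‖inner ℂ (b i) (mulChar Ω hΩ (landauBasis n a))‖ ^ 2) else 0) =
      ∫⁻ z in Ω, (if (level a : ℝ) ≤ t then ENNReal.ofReal (‖basisFun a z‖ ^ 2) else 0)
        ∂(gaussianMeasure n) := by
    intro a
    split_ifs
    · exact h2 a
    · simp
  have h4 : ∀ z : Cn n,
      (∑' a : Idx n, if (level a : ℝ) ≤ t then ENNReal.ofReal (‖basisFun a z‖ ^ 2) else 0) =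
      ENNReal.ofReal ((levelSet n t).card / Real.pi ^ n) * ENNReal.ofReal (Real.exp (sqNorm z)) := by
    intro z
    have h := hasSum_sq_norm_basisFun t z
    rw [← ENNReal.ofReal_mul (by positivity), ← h.tsum_eq,
      ENNReal.ofReal_tsum_of_nonneg _ h.summable]
    · refine tsum_congr fun a => ?_
      split_ifs <;> simp
    · intro a
      split_ifs <;> positivity
  simp only [h1]
  rw [ENNReal.tsum_comm]
  simp only [h3]
  rw [← lintegral_tsum]
  · simp only [h4]
    rw [lintegral_const_mul' _ _ ENNReal.ofReal_ne_top, setLIntegral_exp_sqNorm hΩ]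
  · intro a
    split_ifs
    · exact ((continuous_basisFun a).norm.pow 2).measurable.ennreal_ofReal.aemeasurable
    · exact aemeasurable_const

/-- With `P` an orthogonal projection and `χ` self-adjoint, the diagonal entries of `χPχ` are the
nonnegative numbers `‖P χ b_i‖²`, so finiteness of their sum gives summability. -/
theorem hasTrace_mulChar_proj_mulChar (t : ℝ) {Ω : Set (Cn n)} (hΩ : MeasurableSet Ω)
    (hv : volume Ω ≠ ⊤) :
    HasTrace (mulChar Ω hΩ ∘L (landauFamily n).proj t ∘L mulChar Ω hΩ)
      (((levelSet n t).card / Real.pi ^ n * volume.real Ω : ℝ) : ℂ) := by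
  intro ι b
  have h := tsum_ofReal_norm_sq_proj_mulChar t hΩ b
  have hne : ∑' i, ENNReal.ofReal (‖(landauFamily n).proj t (mulChar Ω hΩ (b i))‖ ^ 2) ≠ ⊤ := by
    rw [h]
    exact ENNReal.mul_ne_top ENNReal.ofReal_ne_top hv
  have h1 := ENNReal.hasSum_toReal hne
  rw [← ENNReal.tsum_toReal_eq (ENNReal.ne_top_of_tsum_ne_top hne), h, ENNReal.toReal_mul,
    ENNReal.toReal_ofReal (by positivity)] at h1
  have h2 : HasSum (fun i => ((ENNReal.ofReal
      (‖(landauFamily n).proj t (mulChar Ω hΩ (b i))‖ ^ 2)).toReal : ℂ))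
      (((levelSet n t).card / Real.pi ^ n * volume.real Ω : ℝ) : ℂ) := by
    exact_mod_cast h1
  refine HasSum.congr_term h2 fun i => ?_
  rw [ENNReal.toReal_ofReal (by positivity), ContinuousLinearMap.comp_apply,
    ContinuousLinearMap.comp_apply, inner_mulChar, inner_proj_self]

theorem hasTraceDensity_landauFamily (t : ℝ) :
    HasTraceDensity ((landauFamily n).proj t) ((levelSet n t).card / Real.pi ^ n) := by
  refine ⟨fun Ω => (levelSet n t).card / Real.pi ^ n * volume.real Ω, fun Ω hΩ hb =>
    hasTrace_mulChar_proj_mulChar t hΩ.measurableSet hb.measure_lt_top.ne, ?_⟩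
  -- The quotient already equals its limit once `Ω` contains the unit ball, which makes the volume
  -- nonzero.
  refine tendsto_const_nhds.congr' ?_
  have hmem : {Ω : Set (Cn n) | IsOpen Ω ∧ Bornology.IsBounded Ω ∧ Metric.ball 0 1 ⊆ Ω} ∈
      expanding n := mem_iInf_of_mem 1 (mem_principal_self _)
  filter_upwards [hmem] with Ω ⟨_, hb, hs⟩
  have hpos : 0 < volume Ω := (Metric.measure_ball_pos volume 0 one_pos).trans_le (measure_mono hs)
  rw [mul_div_assoc, div_self, mul_one]
  rw [Measure.real]
  exact (ENNReal.toReal_pos hpos.ne' hb.measure_lt_top.ne).ne'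

theorem isIntegratedDensityOfStates_landauFamily (n : ℕ) :
    IsIntegratedDensityOfStates (landauFamily n) fun t : ℝ =>
      if 0 ≤ t then
        ((⌊t⌋₊ + n).factorial : ℝ) / (Real.pi ^ n * (⌊t⌋₊.factorial : ℝ) * (n.factorial : ℝ))
      else 0 := by
  intro t
  simp only [← card_levelSet_div]
  exact ⟨hasTraceDensity_landauFamily t, hasKernelDensity_landauFamily t⟩

end MagneticLaplacian

end

theorem proposition2p1 (n : ℕ) (hn : 1 ≤ n) :
    (∃! E : MagneticLaplacian.SpectralFamily (MagneticLaplacian.L2 n),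
      E.Decomposes (MagneticLaplacian.magneticLaplacian n)) ∧
    ∀ E : MagneticLaplacian.SpectralFamily (MagneticLaplacian.L2 n),
      E.Decomposes (MagneticLaplacian.magneticLaplacian n) →
      MagneticLaplacian.IsIntegratedDensityOfStates E (fun t : ℝ =>
        if 0 ≤ t then
          ((⌊t⌋₊ + n).factorial : ℝ) / (Real.pi ^ n * (⌊t⌋₊.factorial : ℝ) * (n.factorial : ℝ))
        else 0) := by
  refine ⟨⟨MagneticLaplacian.landauFamily n, MagneticLaplacian.landauFamily_decomposes n,
    fun E hE => MagneticLaplacian.eq_landauFamily hE⟩, fun E hE => ?_⟩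
  rw [MagneticLaplacian.eq_landauFamily hE]
  exact MagneticLaplacian.isIntegratedDensityOfStates_landauFamily n
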